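/- Let $K$ be a field of characteristic $0$, let $n \ge 1$, and let $\mu = (\mu_1 \ge \mu_2 \ge \dots)$ be a partition of $n$ (with $\mu_j = 0$ beyond the last part). For $1 \le i \le n$ put $\mu(i) = \mu_1 + \dots + \mu_i - i + 1$. Let $A = K[\Phi_{a,b} : 1 \le a,b \le n]$ be the coordinate ring of the space of $n \times n$ matrices over $K$, with generic matrix $\Phi = (\Phi_{a,b})$, on which $GL_n(K)$ acts by $(g\cdot f)(\phi) = f(g^{-1}\phi g)$. For $1 \le p \le n$ the linear span of the $p \times p$ minors of $\Phi$ is a $GL_n(K)$-stable subspace of $A$, isomorphic to $$\textstyle\bigwedge^p E \otimes \bigwedge^p E^* \;\cong\; \bigoplus_{j=0}^{\min(p,n-p)} S_{(1^j,0^{n-2j},(-1)^j)}E, \qquad E = K^n,$$ where $S_\lambda E$ denotes the irreducible representation of highest weight $\lambda$. Let $U_{j,p} \subseteq A$ denote the summand of this span isomorphic to $S_{(1^j,0^{n-2j},(-1)^j)}E$, with $U_{j,p} = 0$ if $j > \min(p,n-p)$. Let $1 \le i \le n$. Suppose that $U_{i,\mu(i)} \ne 0$ and, if $i \ge 2$,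 that $$\mu(i) < \mu(i-1) + \left\lfloor \frac{\mu(i-1)-1}{i-1} \right\rfloor$$ (for $i = 1$ no such condition is imposed). Then $U_{i,\mu(i)}$ is not contained in the ideal of $A$ generated by $$U_{0,1}, \dots, U_{0,\mu_1},\; U_{1,\mu(1)}, \dots, U_{i-1,\mu(i-1)}.$$ -/

import Mathlib

open MvPolynomial

noncomputable section

namespace NilpotentOrbit

/-! ### Partitions -/

/-- The part `μ_j` of a partition, for `j = 1, 2, …`, the parts being listed in weakly decreasing
order and continued by zeros. (The value at `j = 0` is not used.) -/
def part {n : ℕ} (μ : n.Partition) (j : ℕ) : ℕ :=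
  (μ.parts.sort (· ≥ ·)).getD (j - 1) 0

/-- The number `μ(i) = μ_1 + ⋯ + μ_i - i + 1`. For `i ≤ n` one has
`μ_1 + ⋯ + μ_i ≥ i` if `i` is at most the number of parts, and `μ_1 + ⋯ + μ_i = n ≥ i` otherwise,
so the subtraction of natural numbers is the true one and `1 ≤ μ(i)`. -/
def level {n : ℕ} (μ : n.Partition) (i : ℕ) : ℕ :=
  (∑ j ∈ Finset.Icc 1 i, part μ j) + 1 - i

/-! ### The coordinate ring of `n × n` matrices and the conjugation action -/

/-- The coordinate ring `A = K[X]` of the space `X` of `n × n` matrices over `K`. -/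
abbrev CoordRing (n : ℕ) (K : Type*) [Field K] : Type _ := MvPolynomial (Fin n × Fin n) K

variable (n : ℕ) (K : Type*) [Field K]

/-- The generic matrix `Φ = (Φ_{a,b})`, whose entries are the coordinate functions. -/
def generic : Matrix (Fin n) (Fin n) (CoordRing n K) :=
  Matrix.mvPolynomialX (Fin n) (Fin n) K

/-- A constant matrix, viewed as a matrix over the coordinate ring. -/
def const (g : Matrix (Fin n) (Fin n) K) : Matrix (Fin n) (Fin n) (CoordRing n K) :=
  g.map (algebraMap K (CoordRing n K))

/-- Substitution of the entries of `g⁻¹ Φ g` for those of `Φ`, that is,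
`(g • f)(φ) = f (g⁻¹ φ g)`. -/
def conjHom (g : GL (Fin n) K) : CoordRing n K →ₐ[K] CoordRing n K :=
  aeval fun ab : Fin n × Fin n =>
    (const n K (↑g⁻¹ : Matrix (Fin n) (Fin n) K) * generic n K *
      const n K (↑g : Matrix (Fin n) (Fin n) K)) ab.1 ab.2

theorem const_mul (g h : Matrix (Fin n) (Fin n) K) :
    const n K (g * h) = const n K g * const n K h := by
  simp [const, Matrix.map_mul]

theorem const_one : const n K 1 = 1 :=
  Matrix.map_one _ (map_zero _) (map_one _)

theorem generic_map_conjHom (g : GL (Fin n) K) :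
    (generic n K).map (conjHom n K g) =
      const n K (↑g⁻¹ : Matrix (Fin n) (Fin n) K) * generic n K *
        const n K (↑g : Matrix (Fin n) (Fin n) K) := by
  ext a b : 1
  simp [generic, conjHom]

theorem const_map_conjHom (g : GL (Fin n) K) (h : Matrix (Fin n) (Fin n) K) :
    (const n K h).map (conjHom n K g) = const n K h := by
  ext a b : 1
  simp only [const, Matrix.map_apply]
  exact AlgHom.commutes _ _

theorem conjHom_X (g : GL (Fin n) K) (a b : Fin n) :
    conjHom n K g (X (a, b)) =
      (const n K (↑g⁻¹ : Matrix (Fin n) (Fin n) K) * generic n K *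
        const n K (↑g : Matrix (Fin n) (Fin n) K)) a b := by
  simp [conjHom]

/-- The representation of `GL(n)` on the coordinate ring induced by the conjugation action. -/
def conjRep : Representation K (GL (Fin n) K) (CoordRing n K) where
  toFun g := (conjHom n K g).toLinearMap
  map_one' := by
    have h : conjHom n K 1 = AlgHom.id K (CoordRing n K) := by
      ext ab : 1
      rw [conjHom_X]
      simp [const_one, generic]
    rw [h]
    rfl
  map_mul' g h := by
    have key : conjHom n K (g * h) = (conjHom n K g).comp (conjHom n K h) := by
      ext ab : 1
      obtain ⟨a, b⟩ := ab
      rw [AlgHom.comp_apply, conjHom_X, conjHom_X]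
      have e : (const n K (↑h⁻¹ : Matrix (Fin n) (Fin n) K) * generic n K *
          const n K (↑h : Matrix (Fin n) (Fin n) K)).map (conjHom n K g) =
          const n K (↑(g * h)⁻¹ : Matrix (Fin n) (Fin n) K) * generic n K *
          const n K (↑(g * h) : Matrix (Fin n) (Fin n) K) := by
        rw [Matrix.map_mul, Matrix.map_mul, const_map_conjHom, const_map_conjHom,
          generic_map_conjHom, mul_inv_rev, Units.val_mul, Units.val_mul, const_mul, const_mul]
        simp only [Matrix.mul_assoc]
      rw [← e, Matrix.map_apply]
    rw [key]
    rfl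

/-! ### Highest weight vectors -/

variable {n K} in
/-- `v` is a highest weight vector of weight `w` for the representation `ρ` of `GL(n)`: it is
nonzero, it is fixed by the upper triangular matrices with ones on the diagonal, and the diagonal
matrix `diag(t_1, …, t_n)` multiplies it by `t_1 ^ w_1 ⋯ t_n ^ w_n`. -/
structure IsHighestWeightVector {V : Type*} [AddCommGroup V] [Module K V]
    (ρ : Representation K (GL (Fin n) K) V) (w : Fin n → ℤ) (v : V) : Prop where
  ne_zero : v ≠ 0
  unipotent : ∀ g : GL (Fin n) K, (∀ a, g a a = 1) → (∀ a b, b < a → g a b = 0) → ρ g v = v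
  torus : ∀ (g : GL (Fin n) K) (t : Fin n → K), (g : Matrix (Fin n) (Fin n) K) =
    Matrix.diagonal t → ρ g v = (∏ k, t k ^ w k) • v

/-- The weight `(1^j, 0^{n-2j}, (-1)^j)`; meaningful for `2j ≤ n`. -/
def weight (j : ℕ) (k : Fin n) : ℤ :=
  if (k : ℕ) < j then 1 else if n ≤ (k : ℕ) + j then -1 else 0

/-! ### The spaces of equations -/

/-- The linear span of the `p × p` minors of the generic matrix `Φ`, the sets of rows and columns
being given by their increasing enumerations. It is a copy of `⋀^p E ⊗ ⋀^p E^*`. -/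
def minorSpan (p : ℕ) : Submodule K (CoordRing n K) :=
  Submodule.span K
    {f | ∃ r c : Fin p ↪o Fin n, f = ((generic n K).submatrix r c).det}

/-- The space `U_{j,p}`: the summand `S_{(1^j, 0^{n-2j}, (-1)^j)} E` of the span of the `p × p`
minors, i.e. the sum of all irreducible subrepresentations of that span with highest weight
`(1^j, 0^{n-2j}, (-1)^j)`. It is zero if there are none, in particular if `2j > n`, when this is
not a weight. -/
def U (j p : ℕ) : Submodule K (CoordRing n K) :=
  ⨆ (σ : Subrepresentation (conjRep n K))
    (_ : 2 * j ≤ n ∧ σ.toSubmodule ≤ minorSpan n K p ∧ σ.toRepresentation.IsIrreducible ∧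
      ∃ v ∈ σ.toSubmodule, IsHighestWeightVector (conjRep n K) (weight n j) v),
    σ.toSubmodule

variable {n} in
/-- The ideal of `A` generated by `U_{0,1}, …, U_{0,μ_1}, U_{1,μ(1)}, …, U_{i-1,μ(i-1)}`. -/
def previousIdeal (μ : n.Partition) (i : ℕ) : Ideal (CoordRing n K) :=
  Ideal.span
    ((⋃ p ∈ Set.Icc 1 (part μ 1), (U n K 0 p : Set (CoordRing n K))) ∪
      ⋃ j ∈ Set.Ico 1 i, (U n K j (level μ j) : Set (CoordRing n K)))

end NilpotentOrbit

end

/-! The ideal is separated from `U_{i,μ(i)}` by a single nilpotent matrix `φ`: every generator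
vanishes at `φ`, while a highest weight vector of `U_{i,μ(i)}` does not.

Torus weights and invariance under elementary unipotents force a highest weight vector of `U_{j,p}`
to be a nonzero multiple of an explicit sum of minors (`IsHighestWeightVector.exists_eq_sum_cut`).
By `coeff_det_pencil` this sum is the coefficient of `t^(n-j-p)` in `det (pencil j ψ)`, which is up
to sign a minor of `t + ψ` of size `n - j`. If `ψ` is nilpotent, the elementary divisors of `t + ψ`
are `t^len` for the Jordan block sizes `len`, so such a minor is divisible by `t` to the power `n`
minus the sum of the `j` largest sizes (`ColumnsDivisible.pow_dvd_det_pencil`). This holds on the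
whole conjugacy class, so irreducibility carries the vanishing from the highest weight vector to all
of `U_{j,p}` (`evalAt_eq_zero_of_mem_U`).

Since `n - j - μ(j) = n - (μ_1 + ⋯ + μ_j) - 1`, the space `U_{j,μ(j)}` vanishes at `φ` as soon as
the `j` largest blocks have total size at most `μ_1 + ⋯ + μ_j`. Take `i - 1` almost equal blocks of
total size `μ_1 + ⋯ + μ_{i-1}`, one block of size `μ_i + 1`, and blocks of size `1`. The numerical
hypothesis says exactly that `μ_i + 1` does not exceed the smaller of the almost equal sizes, so the
bound holds for all `j < i` (`sum_blockExponent_le_partialSum`). The first `i` blocks exceed `μ_1 +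
⋯ + μ_i` by one, and for a suitable ordering of the Jordan basis the relevant coefficient is nonzero
(`coeff_det_pencil_jordan_ne_zero`). -/

noncomputable section

namespace NilpotentOrbit

variable {n : ℕ} {K : Type*} [Field K]

/-! ### Evaluation at matrices -/

/-- Evaluation of a polynomial function at a matrix. -/
def evalAt (ψ : Matrix (Fin n) (Fin n) K) : CoordRing n K →ₐ[K] K :=
  aeval fun ab : Fin n × Fin n => ψ ab.1 ab.2

theorem generic_map_evalAt (ψ : Matrix (Fin n) (Fin n) K) :
    (generic n K).map (evalAt ψ) = ψ := by
  ext a b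
  simp [generic, evalAt]

theorem const_map_evalAt (ψ h : Matrix (Fin n) (Fin n) K) :
    (const n K h).map (evalAt ψ) = h := by
  ext a b
  simp [const, evalAt]

theorem evalAt_conjRep (ψ : Matrix (Fin n) (Fin n) K) (g : GL (Fin n) K) (f : CoordRing n K) :
    evalAt ψ (conjRep n K g f) =
      evalAt ((↑g⁻¹ : Matrix (Fin n) (Fin n) K) * ψ * (↑g : Matrix (Fin n) (Fin n) K)) f := by
  have key : (evalAt ψ).comp (conjHom n K g) =
      evalAt ((↑g⁻¹ : Matrix (Fin n) (Fin n) K) * ψ * (↑g : Matrix (Fin n) (Fin n) K)) := by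
    ext ab : 1
    obtain ⟨a, b⟩ := ab
    rw [AlgHom.comp_apply, conjHom_X, ← Matrix.map_apply (f := evalAt ψ), Matrix.map_mul,
      Matrix.map_mul, const_map_evalAt, const_map_evalAt, generic_map_evalAt]
    simp [evalAt]
  exact DFunLike.congr_fun key f

theorem evalAt_minor {p : ℕ} (ψ : Matrix (Fin n) (Fin n) K) (r c : Fin p → Fin n) :
    evalAt ψ ((generic n K).submatrix r c).det = (ψ.submatrix r c).det := by
  rw [AlgHom.map_det]
  congr 1
  conv_rhs => rw [← generic_map_evalAt ψ]
  rfl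

theorem eq_zero_of_evalAt [CharZero K] {f : CoordRing n K} (h : ∀ ψ, evalAt ψ f = 0) : f = 0 := by
  apply MvPolynomial.funext
  intro x
  have := h (Matrix.of fun a b => x (a, b))
  simpa [evalAt, aeval_eq_eval] using this

/-- An element of the span of the `p × p` minors, as a function on matrices. -/
theorem exists_coeff_of_mem_minorSpan {p : ℕ} {f : CoordRing n K} (hf : f ∈ minorSpan n K p) :
    ∃ c : (Fin p ↪o Fin n) × (Fin p ↪o Fin n) → K, ∀ ψ, evalAt ψ f =
      ∑ q, c q * (ψ.submatrix q.1 q.2).det := by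
  have hs : {f | ∃ r c : Fin p ↪o Fin n, f = ((generic n K).submatrix r c).det} =
      Set.range fun q : (Fin p ↪o Fin n) × (Fin p ↪o Fin n) =>
        ((generic n K).submatrix q.1 q.2).det := by
    ext f
    constructor
    · rintro ⟨r, c, rfl⟩
      exact ⟨(r, c), rfl⟩
    · rintro ⟨q, rfl⟩
      exact ⟨q.1, q.2, rfl⟩
  rw [minorSpan, hs, Submodule.mem_span_range_iff_exists_fun] at hf
  obtain ⟨c, rfl⟩ := hf
  refine ⟨c, fun ψ => ?_⟩
  simp [evalAt_minor]

/-- The partial permutation matrix with ones at the places `(r k, c k)`. -/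
def partialPerm (K : Type*) [Field K] {p : ℕ} (r c : Fin p → Fin n) :
    Matrix (Fin n) (Fin n) K :=
  Matrix.of fun a b => if ∃ k, r k = a ∧ c k = b then 1 else 0

theorem exists_notMem_range {p : ℕ} {r r' : Fin p ↪o Fin n} (h : r ≠ r') :
    ∃ k, ∀ l, r' l ≠ r k := by
  by_contra! hc
  apply h
  rw [← OrderEmbedding.range_inj]
  apply Set.eq_of_subset_of_ncard_le
  · rintro _ ⟨k, rfl⟩
    exact hc k
  · rw [Set.ncard_range_of_injective r.injective, Set.ncard_range_of_injective r'.injective]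
  · exact Set.finite_range _

/-- Partial permutation matrices are dual to the minors, so evaluating at them reads off the
coefficients of a combination of minors. -/
theorem det_partialPerm_submatrix {p : ℕ} (q q' : (Fin p ↪o Fin n) × (Fin p ↪o Fin n)) :
    ((partialPerm K q'.1 q'.2).submatrix q.1 q.2).det = if q = q' then 1 else 0 := by
  split_ifs with h
  · subst h
    have h1 : (partialPerm K q.1 q.2).submatrix q.1 q.2 = 1 := by
      ext k l
      simp [partialPerm, Matrix.one_apply]
    rw [h1, Matrix.det_one]
  · by_cases h1 : q.1 = q'.1
    · have h2 : q.2 ≠ q'.2 := fun h2 => h (Prod.ext h1 h2)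
      obtain ⟨k, hk⟩ := exists_notMem_range h2
      apply Matrix.det_eq_zero_of_column_eq_zero k
      intro l
      simp [partialPerm, hk]
    · obtain ⟨k, hk⟩ := exists_notMem_range h1
      apply Matrix.det_eq_zero_of_row_eq_zero k
      intro l
      simp [partialPerm, hk]

/-! ### Torus weights -/

/-- The diagonal matrix with a `2` in position `x` and ones elsewhere. -/
def torusElt (K : Type*) [Field K] [CharZero K] (x : Fin n) : GL (Fin n) K :=
  ⟨Matrix.diagonal (Function.update 1 x 2), Matrix.diagonal (Function.update 1 x 2⁻¹), by
    rw [Matrix.diagonal_mul_diagonal, ← Matrix.diagonal_one]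
    congr 1
    ext y
    by_cases h : y = x <;> simp [h], by
    rw [Matrix.diagonal_mul_diagonal, ← Matrix.diagonal_one]
    congr 1
    ext y
    by_cases h : y = x <;> simp [h]⟩

theorem prod_update_embedding {p : ℕ} (r : Fin p ↪o Fin n) (x : Fin n) (s : K) :
    ∏ k, (Function.update 1 x s : Fin n → K) (r k) =
      s ^ (if x ∈ Set.range r then 1 else 0 : ℕ) := by
  split_ifs with h
  · obtain ⟨k, rfl⟩ := h
    rw [Finset.prod_eq_single k]
    · simp
    · intro l _ hl
      simp [hl]
    · simp
  · rw [Finset.prod_eq_one]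
    · simp
    · intro l _
      rw [Function.update_of_ne]
      · rfl
      · rintro rfl
        exact h ⟨l, rfl⟩

/-- Each minor is a torus eigenvector whose weight is the indicator of its columns minus that of its
rows. Evaluation at the partial permutation matrix of `q` isolates `c q`, and conjugation by
`torusElt K x` compares powers of `2`. -/
theorem coeff_weight [CharZero K] {p : ℕ} {w : Fin n → ℤ} {f : CoordRing n K}
    (hf : IsHighestWeightVector (conjRep n K) w f)
    {c : (Fin p ↪o Fin n) × (Fin p ↪o Fin n) → K}
    (hc : ∀ ψ, evalAt ψ f = ∑ q, c q * (ψ.submatrix q.1 q.2).det)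
    {q : (Fin p ↪o Fin n) × (Fin p ↪o Fin n)} (hq : c q ≠ 0) (x : Fin n) :
    w x = (if x ∈ Set.range q.2 then 1 else 0) - (if x ∈ Set.range q.1 then 1 else 0) := by
  have h1 := congrArg (evalAt (partialPerm K q.1 q.2))
    (hf.torus (torusElt K x) (Function.update 1 x 2) rfl)
  rw [evalAt_conjRep, map_smul, hc, hc] at h1
  have h2 : ∀ q' : (Fin p ↪o Fin n) × (Fin p ↪o Fin n),
      ((((↑(torusElt K x)⁻¹ : Matrix (Fin n) (Fin n) K) * partialPerm K q.1 q.2 *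
        (↑(torusElt K x) : Matrix (Fin n) (Fin n) K))).submatrix q'.1 q'.2).det =
      (2⁻¹ : K) ^ (if x ∈ Set.range q'.1 then 1 else 0 : ℕ) *
        (2 : K) ^ (if x ∈ Set.range q'.2 then 1 else 0 : ℕ) *
        ((partialPerm K q.1 q.2).submatrix q'.1 q'.2).det := by
    intro q'
    rw [← prod_update_embedding, ← prod_update_embedding, mul_assoc (∏ k, _),
      ← Matrix.det_mul_row, ← Matrix.det_mul_column]
    congr 1
    ext a b
    have e1 : (↑(torusElt K x)⁻¹ : Matrix (Fin n) (Fin n) K) =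
      Matrix.diagonal (Function.update 1 x 2⁻¹) := rfl
    have e2 : (↑(torusElt K x) : Matrix (Fin n) (Fin n) K) =
      Matrix.diagonal (Function.update 1 x 2) := rfl
    simp [e1, e2]
    ring
  simp only [h2, det_partialPerm_submatrix, mul_ite, mul_one, mul_zero, Finset.sum_ite_eq',
    Finset.mem_univ, if_true, smul_eq_mul] at h1
  have h3 : ∏ k, (Function.update 1 x 2 : Fin n → K) k ^ w k = 2 ^ w x := by
    rw [Finset.prod_eq_single x]
    · simp
    · intro y _ hy
      simp [hy]
    · simp
  rw [h3, mul_comm] at h1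
  have h4 := mul_right_cancel₀ hq h1
  have h5 : (2 : K) ^ w x = 2 ^ (((if x ∈ Set.range q.2 then 1 else 0 : ℕ) : ℤ) -
      ((if x ∈ Set.range q.1 then 1 else 0 : ℕ) : ℤ)) := by
    rw [← h4, zpow_sub₀ two_ne_zero, zpow_natCast, zpow_natCast, inv_pow]
    field_simp
  -- The exponents are compared over `ℚ`, where the order makes powers of `2` injective.
  have h6 : ((2 : ℚ) ^ w x : ℚ) = 2 ^ (((if x ∈ Set.range q.2 then 1 else 0 : ℕ) : ℤ) -
      ((if x ∈ Set.range q.1 then 1 else 0 : ℕ) : ℤ)) := by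
    apply Rat.cast_injective (α := K)
    rw [Rat.cast_zpow, Rat.cast_zpow, Rat.cast_ofNat]
    exact h5
  have h7 := zpow_right_injective₀ (by norm_num : (0 : ℚ) < 2) (by norm_num) h6
  push_cast at h7
  exact h7

/-! ### Minors as determinants of full size -/

/-- A minor is, up to sign, the determinant of a square matrix of full size, obtained by
replacing the omitted rows by unit vectors. -/
theorem exists_minor_eq_mul_det {p : ℕ} (r c : Fin p ↪o Fin n) (π : Equiv.Perm (Fin n))
    (hπ : ∀ x, x ∉ Set.range r → π x ∉ Set.range c) :
    ∃ ε : K, ∀ ψ : Matrix (Fin n) (Fin n) K, (ψ.submatrix r c).det = ε *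
      (Matrix.of fun x y => open Classical in if x ∈ Set.range r then ψ x y else
        (1 : Matrix (Fin n) (Fin n) K) (π x) y).det := by
  classical
  let T := {x // x ∉ Set.range r}
  have hcard : Fintype.card (Fin p ⊕ T) = Fintype.card (Fin n) := by
    have h1 := Fintype.card_subtype_compl (fun x => x ∈ Set.range r)
    have h2 : Fintype.card {x // x ∈ Set.range r} = p := by
      rw [← Fintype.card_congr (Equiv.ofInjective r r.injective), Fintype.card_fin]
    have h3 := Fintype.card_subtype_le (fun x => x ∈ Set.range r)
    rw [Fintype.card_sum, h1, h2, Fintype.card_fin]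
    rw [h2] at h3
    simp only [Fintype.card_fin] at h3 ⊢
    omega
  have hinj1 : Function.Injective (Sum.elim r Subtype.val : Fin p ⊕ T → Fin n) := by
    refine r.injective.sumElim Subtype.val_injective ?_
    rintro k ⟨x, hx⟩ rfl
    exact hx ⟨k, rfl⟩
  have hinj2 : Function.Injective (Sum.elim c (fun x => π x.1) : Fin p ⊕ T → Fin n) := by
    refine c.injective.sumElim (π.injective.comp Subtype.val_injective) ?_
    rintro k ⟨x, hx⟩ h
    exact hπ x hx ⟨k, h⟩
  let e1 := Equiv.ofBijective _ ((Fintype.bijective_iff_injective_and_card _).2 ⟨hinj1, hcard⟩)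
  let e2 := Equiv.ofBijective _ ((Fintype.bijective_iff_injective_and_card _).2 ⟨hinj2, hcard⟩)
  refine ⟨((Equiv.Perm.sign (e1.symm.trans e2) : ℤ) : K), fun ψ => ?_⟩
  set N : Matrix (Fin n) (Fin n) K := Matrix.of fun x y => if x ∈ Set.range r then ψ x y else
        (1 : Matrix (Fin n) (Fin n) K) (π x) y with hN
  rw [← Matrix.det_permute', ← Matrix.det_submatrix_equiv_self e1]
  have he : (N.submatrix id (e1.symm.trans e2)).submatrix e1 e1 = N.submatrix e1 e2 := by
    ext a b
    simp
  have hb : N.submatrix e1 e2 =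
      Matrix.fromBlocks (ψ.submatrix r c) (Matrix.of fun k (x : T) => ψ (r k) (π x.1)) 0 1 := by
    ext a b
    rcases a with a | ⟨a, ha⟩ <;> rcases b with b | ⟨b, hb⟩
    · simp [N, e1, e2]
    · simp [N, e1, e2]
    · have : π a ≠ c b := fun h => hπ a ha ⟨b, h.symm⟩
      have ha' : ¬ ∃ y, r y = a := ha
      simp [N, e1, e2, ha', Matrix.one_apply, this]
    · have ha' : ¬ ∃ y, r y = a := ha
      simp [N, e1, e2, ha', Matrix.one_apply]
  rw [he, hb, Matrix.det_fromBlocks_zero₂₁, Matrix.det_one, mul_one]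

/-! ### Shape of the highest weight vectors -/

/-- The indices at which the weight `(1^j, 0^{n-2j}, (-1)^j)` vanishes. -/
def middle (n j : ℕ) : Finset (Fin n) :=
  Finset.univ.filter fun x => j ≤ (x : ℕ) ∧ (x : ℕ) + j < n

theorem mem_middle {j : ℕ} {x : Fin n} : x ∈ middle n j ↔ j ≤ (x : ℕ) ∧ (x : ℕ) + j < n := by
  simp [middle]

/-- The involution of the indices that fixes the middle ones and reverses the order of the
others. -/
def outerRev (n j : ℕ) : Equiv.Perm (Fin n) :=
  Function.Involutive.toPerm (fun x => if x ∈ middle n j then x else Fin.rev x) (by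
    intro x
    by_cases h : x ∈ middle n j
    · simp [h]
    · have : Fin.rev x ∉ middle n j := by
        simp only [mem_middle, Fin.val_rev] at h ⊢
        have := x.2
        omega
      simp [h, this])

theorem outerRev_apply (j : ℕ) (x : Fin n) :
    outerRev n j x = if x ∈ middle n j then x else Fin.rev x := rfl

/-- The matrix obtained from `ψ` by replacing the rows in `S` by the corresponding unit vectors,
and the first `j` rows by the last `j` unit vectors in reverse order. -/
def cut {R : Type*} [CommRing R] (j : ℕ) (S : Finset (Fin n)) (ψ : Matrix (Fin n) (Fin n) R) :
    Matrix (Fin n) (Fin n) R :=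
  Matrix.of fun x => if x ∈ S then (1 : Matrix (Fin n) (Fin n) R) x else
    if (x : ℕ) < j then (1 : Matrix (Fin n) (Fin n) R) (Fin.rev x) else ψ x

theorem card_filter_val_lt {j : ℕ} (hj : j ≤ n) :
    (Finset.univ.filter fun x : Fin n => (x : ℕ) < j).card = j := by
  rw [Fin.card_filter_val_lt, min_eq_right hj]

theorem card_filter_le_add {j : ℕ} (hj : j ≤ n) :
    (Finset.univ.filter fun x : Fin n => n ≤ (x : ℕ) + j).card = j := by
  refine Eq.trans ?_ (card_filter_val_lt hj)
  apply Finset.card_bij (fun x _ => Fin.rev x)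
  · intro x
    have := x.2
    simp only [Finset.mem_filter, Finset.mem_univ, true_and, Fin.val_rev]
    omega
  · intro x _ y _ h
    exact Fin.rev_injective h
  · intro x hx
    refine ⟨Fin.rev x, ?_, Fin.rev_rev x⟩
    have := x.2
    simp only [Finset.mem_filter, Finset.mem_univ, true_and, Fin.val_rev] at hx ⊢
    omega

/-- Weight `1` at `x` means that `x` is a column but not a row of the minor, weight `-1` the
reverse, and weight `0` both or neither. The minor is thus determined by the set `S` of middle
indices it omits; its omitted rows are `S` and the first `j`, its omitted columns `S` and the last
`j`, and `outerRev` matches them. -/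
theorem exists_cut_of_weight {j p : ℕ} (h2j : 2 * j ≤ n) (r c : Fin p ↪o Fin n)
    (hw : ∀ x, weight n j x =
      (if x ∈ Set.range c then 1 else 0) - (if x ∈ Set.range r then 1 else 0)) :
    (j ≤ p ∧ p + j ≤ n) ∧ ∃ S ∈ (middle n j).powersetCard (n - j - p), ∃ ε : K,
      ∀ ψ : Matrix (Fin n) (Fin n) K, (ψ.submatrix r c).det = ε * (cut j S ψ).det := by
  classical
  have key : ∀ x : Fin n, ((x : ℕ) < j → x ∈ Set.range c ∧ x ∉ Set.range r) ∧
      (n ≤ (x : ℕ) + j → x ∉ Set.range c ∧ x ∈ Set.range r) ∧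
      (x ∈ middle n j → (x ∈ Set.range c ↔ x ∈ Set.range r)) := by
    intro x
    have hxn := x.2
    have h := hw x
    rw [mem_middle]
    unfold weight at h
    refine ⟨fun hx => ?_, fun hx => ?_, fun hx => ?_⟩ <;> by_cases h1 : x ∈ Set.range c <;>
      by_cases h2 : x ∈ Set.range r <;> simp only [h1, h2, if_true, if_false] at h <;>
      first
        | (split_ifs at h <;> omega)
        | exact ⟨h1, h2⟩
        | exact iff_of_true h1 h2
        | exact iff_of_false h1 h2
  have hcr : (Finset.univ.filter fun x => x ∈ Set.range r).card = p := by
    have : (Finset.univ.filter fun x => x ∈ Set.range r) = Finset.univ.image r := by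
      ext x
      simp
    rw [this, Finset.card_image_of_injective _ r.injective, Finset.card_univ, Fintype.card_fin]
  set S : Finset (Fin n) := (middle n j).filter fun x => x ∉ Set.range r with hS
  have hcard : n = j + S.card + p := by
    have hd : Disjoint (Finset.univ.filter fun x : Fin n => (x : ℕ) < j) S := by
      rw [Finset.disjoint_left]
      intro x hx hx'
      rw [hS, Finset.mem_filter, mem_middle] at hx'
      rw [Finset.mem_filter] at hx
      omega
    have hu : (Finset.univ.filter fun x => ¬ x ∈ Set.range r) =
        (Finset.univ.filter fun x : Fin n => (x : ℕ) < j) ∪ S := by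
      ext x
      simp only [hS, Finset.mem_filter, Finset.mem_univ, true_and, Finset.mem_union]
      constructor
      · intro hx
        by_cases h1 : (x : ℕ) < j
        · exact Or.inl h1
        · refine Or.inr ⟨?_, hx⟩
          rw [mem_middle]
          by_contra h2
          exact hx ((key x).2.1 (by omega)).2
      · rintro (h | h)
        · exact ((key x).1 h).2
        · exact h.2
    have h1 := Finset.card_filter_add_card_filter_not (s := (Finset.univ : Finset (Fin n)))
      (fun x => x ∈ Set.range r)
    rw [hu, Finset.card_union_of_disjoint hd, card_filter_val_lt (by omega), hcr,
      Finset.card_univ, Fintype.card_fin] at h1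
    omega
  have hjp : j ≤ p := by
    rw [← hcr, ← card_filter_le_add (n := n) (j := j) (by omega)]
    apply Finset.card_le_card
    intro x
    simp only [Finset.mem_filter, Finset.mem_univ, true_and]
    exact fun h => ((key x).2.1 h).2
  refine ⟨⟨hjp, by omega⟩, S, ?_, ?_⟩
  · rw [Finset.mem_powersetCard]
    exact ⟨Finset.filter_subset _ _, by omega⟩
  · obtain ⟨ε, hε⟩ := exists_minor_eq_mul_det (K := K) r c (outerRev n j) (by
      intro x hx
      rw [outerRev_apply]
      split_ifs with hm
      · rwa [(key x).2.2 hm]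
      · by_cases h1 : (x : ℕ) < j
        · exact ((key (Fin.rev x)).2.1 (by rw [Fin.val_rev]; omega)).1
        · rw [mem_middle] at hm
          exact absurd ((key x).2.1 (by omega)).2 hx)
    refine ⟨ε, fun ψ => ?_⟩
    rw [hε]
    congr 2
    ext x y
    simp only [cut, Matrix.of_apply]
    by_cases hx : x ∈ Set.range r
    · have h1 : ¬ (x : ℕ) < j := fun h => ((key x).1 h).2 hx
      have h2 : x ∉ S := fun h => (Finset.mem_filter.1 h).2 hx
      simp only [hx, h1, h2, if_true, if_false]
    · by_cases hm : x ∈ middle n j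
      · have h2 : x ∈ S := by simp only [hS, Finset.mem_filter]; exact ⟨hm, hx⟩
        simp only [hx, h2, hm, Matrix.one_apply, outerRev_apply, if_true, if_false]
      · have h1 : (x : ℕ) < j := by
          by_contra h1
          rw [mem_middle] at hm
          exact hx ((key x).2.1 (by omega)).2
        have h2 : x ∉ S := by simp [hS, hm]
        simp only [hx, h1, h2, hm, Matrix.one_apply, outerRev_apply, if_true, if_false]

theorem exists_cut_decomposition [CharZero K] {j p : ℕ} (h2j : 2 * j ≤ n) {f : CoordRing n K}
    (hf : IsHighestWeightVector (conjRep n K) (weight n j) f) (hmem : f ∈ minorSpan n K p) :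
    (j ≤ p ∧ p + j ≤ n) ∧ ∃ c : Finset (Fin n) → K, ∀ ψ, evalAt ψ f =
      ∑ S ∈ (middle n j).powersetCard (n - j - p), c S * (cut j S ψ).det := by
  classical
  obtain ⟨c, hc⟩ := exists_coeff_of_mem_minorSpan hmem
  have key := fun q (hq : c q ≠ 0) => exists_cut_of_weight (K := K) h2j q.1 q.2
    (coeff_weight hf hc hq)
  constructor
  · obtain ⟨q, hq⟩ : ∃ q, c q ≠ 0 := by
      by_contra! h
      exact hf.ne_zero (eq_zero_of_evalAt fun ψ => by simp [hc, h])
    exact (key q hq).1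
  · have h2 : ∀ q, ∃ c' : Finset (Fin n) → K, ∀ ψ : Matrix (Fin n) (Fin n) K,
        c q * (ψ.submatrix q.1 q.2).det =
        ∑ S ∈ (middle n j).powersetCard (n - j - p), c' S * (cut j S ψ).det := by
      intro q
      by_cases hq : c q = 0
      · exact ⟨0, fun ψ => by simp [hq]⟩
      · obtain ⟨S, hS, ε, hε⟩ := (key q hq).2
        refine ⟨Pi.single S (c q * ε), fun ψ => ?_⟩
        rw [Finset.sum_eq_single S, hε, Pi.single_eq_same, mul_assoc]
        · intro S' _ h
          rw [Pi.single_eq_of_ne h, zero_mul]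
        · exact fun h => absurd hS h
    choose c' hc' using h2
    refine ⟨fun S => ∑ q, c' q S, fun ψ => ?_⟩
    simp only [hc, hc', Finset.sum_mul]
    exact Finset.sum_comm

/-- An elementary matrix as an element of the general linear group. -/
def elementary (K : Type*) [Field K] {x y : Fin n} (h : x ≠ y) : GL (Fin n) K :=
  ⟨Matrix.transvection x y 1, Matrix.transvection x y (-1), by
    rw [Matrix.transvection_mul_transvection_same _ _ h]; simp, by
    rw [Matrix.transvection_mul_transvection_same _ _ h]; simp⟩

theorem det_outerRev_ne_zero (j : ℕ) :
    ((1 : Matrix (Fin n) (Fin n) K).submatrix (outerRev n j) id).det ≠ 0 := by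
  rw [Matrix.det_permute, Matrix.det_one, mul_one]
  rcases Int.units_eq_one_or (Equiv.Perm.sign (outerRev n j)) with h | h <;> simp [h]

/-- The invariance of `f` under one elementary matrix is tested at a `φ` so sparse that every term
of `f` vanishes at `φ`, while at its conjugate `φ'` only the terms of `insert x S` and `insert y S`
survive, with opposite signs. -/
theorem coeff_insert_eq {j : ℕ} {f : CoordRing n K}
    {k : ℕ} {c : Finset (Fin n) → K}
    (hf : ∀ g : GL (Fin n) K, (∀ a, g a a = 1) → (∀ a b, b < a → g a b = 0) →
      conjRep n K g f = f)
    (hc : ∀ ψ, evalAt ψ f = ∑ S ∈ (middle n j).powersetCard k, c S * (cut j S ψ).det)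
    {S : Finset (Fin n)} {x y : Fin n} (hS : S ⊆ middle n j) (hk : S.card + 1 = k)
    (hx : x ∈ middle n j) (hy : y ∈ middle n j) (hxS : x ∉ S) (hyS : y ∉ S) (hxy : x < y) :
    c (insert x S) = c (insert y S) := by
  classical
  have hne : x ≠ y := hxy.ne
  let base : Matrix (Fin n) (Fin n) K := Matrix.of fun a =>
    if a ∈ insert x (insert y S) ∨ (a : ℕ) < j then 0 else
      (1 : Matrix (Fin n) (Fin n) K) (outerRev n j a)
  let φ := base.updateRow y (Pi.single x 1)
  let φ' := (base.updateRow x (-(Pi.single x 1 + Pi.single y 1))).updateRow y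
    (Pi.single x 1 + Pi.single y 1)
  have hmid : ∀ z ∈ middle n j, ¬ (z : ℕ) < j := fun z hz => by
    rw [mem_middle] at hz
    omega
  have hconj : (↑(elementary K hne)⁻¹ : Matrix (Fin n) (Fin n) K) * φ *
      (↑(elementary K hne) : Matrix (Fin n) (Fin n) K) = φ' := by
    have h1 : φ * (↑(elementary K hne) : Matrix (Fin n) (Fin n) K) =
        (↑(elementary K hne) : Matrix (Fin n) (Fin n) K) * φ' := by
      change φ * Matrix.transvection x y 1 = Matrix.transvection x y 1 * φ'
      have hcol : ∀ a, a ≠ y → φ a x = 0 := by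
        intro a ha
        simp only [φ, Matrix.updateRow_ne ha, base, Matrix.of_apply]
        split_ifs with h
        · rfl
        · rw [Matrix.one_apply_ne]
          intro h3
          have : a = x := by
            rw [← (outerRev n j).injective.eq_iff, h3, outerRev_apply, if_pos hx]
          subst this
          simp at h
      ext a b
      have hR : (φ * Matrix.transvection x y (1 : K) : Matrix (Fin n) (Fin n) K) a b = φ a b + if b = y then φ a x else 0 := by
        by_cases hb : b = y
        · subst hb
          rw [Matrix.mul_transvection_apply_same]
          simp
        · rw [Matrix.mul_transvection_apply_of_ne _ _ _ _ hb]
          simp [hb]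
      have hL : (Matrix.transvection x y (1 : K) * φ' : Matrix (Fin n) (Fin n) K) a b = φ' a b + if a = x then φ' y b else 0 := by
        by_cases ha : a = x
        · subst ha
          rw [Matrix.transvection_mul_apply_same]
          simp
        · rw [Matrix.transvection_mul_apply_of_ne _ _ _ _ ha]
          simp [ha]
      rw [hR, hL]
      by_cases hay : a = y
      · subst hay
        simp [φ, φ', hne.symm, Pi.single_apply]
      · rw [hcol a hay]
        by_cases hax : a = x
        · subst hax
          simp [φ, φ', hne, base, Matrix.updateRow_ne]
        · simp [φ, φ', hay, hax, Matrix.updateRow_ne]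
    rw [Matrix.mul_assoc, h1, ← Matrix.mul_assoc, Units.inv_mul, one_mul]
  have hinv := congrArg (evalAt φ) (hf (elementary K hne) (by
      intro a
      change Matrix.transvection x y (1 : K) a a = 1
      simp only [Matrix.transvection, Matrix.add_apply, Matrix.one_apply_eq]
      rw [Matrix.single_apply_of_ne]
      · simp
      · rintro ⟨rfl, h⟩
        exact hne h.symm) (by
      intro a b hba
      change Matrix.transvection x y (1 : K) a b = 0
      simp only [Matrix.transvection, Matrix.add_apply, Matrix.one_apply_ne hba.ne']
      rw [Matrix.single_apply_of_ne]
      · simp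
      · rintro ⟨rfl, rfl⟩
        exact absurd hxy hba.asymm))
  rw [evalAt_conjRep, hconj, hc, hc] at hinv
  have hzero : ∀ S' : Finset (Fin n), ∀ z ∈ S, z ∉ S' → (cut j S' φ).det = 0 ∧
      (cut j S' φ').det = 0 := by
    intro S' z hz hz'
    have h1 : z ≠ x := fun h => hxS (h ▸ hz)
    have h2 : z ≠ y := fun h => hyS (h ▸ hz)
    constructor <;>
    · apply Matrix.det_eq_zero_of_row_eq_zero z
      intro b
      simp [cut, hz', hmid z (hS hz), φ, φ', h1, h2, base, hz, Matrix.updateRow_ne]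
  -- At `φ` the rows in `S` and row `x` are zero, so only `insert x S` could contribute; for it,
  -- rows `x` and `y` both equal the unit vector at `x`.
  rw [Finset.sum_eq_zero (s := (middle n j).powersetCard k)
    (f := fun S' => c S' * (cut j S' φ).det)] at hinv
  swap
  · intro S' hS'
    rw [Finset.mem_powersetCard] at hS'
    apply mul_eq_zero_of_right
    by_cases hsub : insert x S ⊆ S'
    · have : insert x S = S' := Finset.eq_of_subset_of_card_le hsub (by
        rw [Finset.card_insert_of_notMem hxS]; omega)
      subst this
      apply Matrix.det_zero_of_row_eq hne
      ext b
      simp [cut, hne.symm, hyS, hmid y hy, φ, Matrix.one_apply, Pi.single_apply, eq_comm (a := b)]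
    · rw [Finset.insert_subset_iff, not_and_or, Finset.not_subset] at hsub
      rcases hsub with h | ⟨z, hz, hz'⟩
      · apply Matrix.det_eq_zero_of_row_eq_zero x
        intro b
        simp [cut, h, hmid x hx, φ, hne, base, Matrix.updateRow_ne]
      · exact (hzero S' z hz hz').1
  set Q := (1 : Matrix (Fin n) (Fin n) K).submatrix (outerRev n j) id with hQ
  have hQx : Q x = Pi.single x 1 := by
    ext b
    simp [hQ, outerRev_apply, hx, Matrix.one_apply, Pi.single_apply, eq_comm]
  have hQy : Q y = Pi.single y 1 := by
    ext b
    simp [hQ, outerRev_apply, hy, Matrix.one_apply, Pi.single_apply, eq_comm]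
  have hother : ∀ S' : Finset (Fin n), ∀ a, a ≠ x → a ≠ y → (a ∈ S' ↔ a ∈ S) →
      cut j S' φ' a = Q a := by
    intro S' a hax hay haS
    ext b
    by_cases h1 : a ∈ S
    · simp [cut, haS, h1, hQ, Matrix.one_apply, outerRev_apply, hS h1]
    · by_cases h2 : (a : ℕ) < j
      · have h3 : a ∉ middle n j := fun h => hmid a h h2
        simp [cut, haS, h1, h2, hQ, Matrix.one_apply, outerRev_apply, h3]
      · simp [cut, haS, h1, h2, hQ, Matrix.one_apply, φ', hax, hay, base, Matrix.updateRow_ne]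
  have hdx : (cut j (insert x S) φ').det = Q.det := by
    rw [← Matrix.det_updateRow_add_self Q hne.symm]
    congr 1
    ext a b
    by_cases hay : a = y
    · subst hay
      rw [Matrix.updateRow_self, hQx, hQy]
      simp [cut, hne.symm, hyS, hmid a hy, φ', add_comm]
    · rw [Matrix.updateRow_ne hay]
      by_cases hax : a = x
      · subst hax
        rw [hQx]
        simp [cut, Matrix.one_apply, Pi.single_apply, eq_comm]
      · rw [hother _ a hax hay (by simp [hax])]
  have hdy : (cut j (insert y S) φ').det = -Q.det := by
    rw [← Matrix.det_updateRow_add_self Q hne, ← neg_one_mul, ← Matrix.det_updateRow_smul]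
    congr 1
    ext a b
    by_cases hax : a = x
    · subst hax
      rw [Matrix.updateRow_self, hQx, hQy]
      simp [cut, hne, hxS, hmid a hx, φ', Matrix.updateRow_ne]
    · rw [Matrix.updateRow_ne hax]
      by_cases hay : a = y
      · subst hay
        rw [hQy]
        simp [cut, Matrix.one_apply, Pi.single_apply, eq_comm]
      · rw [hother _ a hax hay (by simp [hay])]
  have hins : insert x S ≠ insert y S := fun h => by
    have := h ▸ Finset.mem_insert_self x S
    simp [hne, hxS] at this
  rw [Finset.sum_eq_add (insert x S) (insert y S) hins, hdx, hdy] at hinv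
  · have h1 : (c (insert x S) - c (insert y S)) * Q.det = 0 := by
      rw [← hinv]
      ring
    exact sub_eq_zero.1 ((mul_eq_zero.1 h1).resolve_right (det_outerRev_ne_zero j))
  -- For any other set containing `S`, neither `x` nor `y` is cut, and rows `x` and `y` of `φ'` are
  -- negatives of each other.
  · rintro S' hS' ⟨h1, h2⟩
    rw [Finset.mem_powersetCard] at hS'
    apply mul_eq_zero_of_right
    by_cases hsub : S ⊆ S'
    · have hnot : ∀ z, z ∉ S → S' ≠ insert z S → z ∉ S' := by
        intro z hz hzS hz'
        apply hzS
        symm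
        apply Finset.eq_of_subset_of_card_le (Finset.insert_subset hz' hsub)
        rw [Finset.card_insert_of_notMem hz]
        omega
      rw [← Matrix.det_updateRow_add_self _ hne]
      apply Matrix.det_eq_zero_of_row_eq_zero x
      intro b
      rw [Matrix.updateRow_self]
      simp [cut, hnot x hxS h1, hnot y hyS h2, hmid x hx, hmid y hy, φ', hne, Matrix.updateRow_ne]
    · obtain ⟨z, hz, hz'⟩ := Finset.not_subset.1 hsub
      exact (hzero S' z hz hz').2
  · intro h
    refine absurd (Finset.mem_powersetCard.2 ⟨Finset.insert_subset hx hS, ?_⟩) h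
    rw [Finset.card_insert_of_notMem hxS, hk]
  · intro h
    refine absurd (Finset.mem_powersetCard.2 ⟨Finset.insert_subset hy hS, ?_⟩) h
    rw [Finset.card_insert_of_notMem hyS, hk]

/-- A function on the `k`-element subsets of `M` that is unchanged when one element is exchanged
is constant. -/
theorem eq_of_exchange {α β : Type*} [DecidableEq α] (M : Finset α) (c : Finset α → β)
    (h : ∀ (S : Finset α) (x y : α), S ⊆ M → x ∈ M → y ∈ M → x ∉ S → y ∉ S →
      c (insert x S) = c (insert y S)) (k : ℕ) (S T : Finset α) (hS : S ∈ M.powersetCard k)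
    (hT : T ∈ M.powersetCard k) : c S = c T := by
  rw [Finset.mem_powersetCard] at hS hT
  induction hm : (S \ T).card generalizing S with
  | zero =>
    rw [Finset.card_eq_zero, Finset.sdiff_eq_empty_iff_subset] at hm
    rw [Finset.eq_of_subset_of_card_le hm (by omega)]
  | succ m ih =>
    obtain ⟨x, hx⟩ : (S \ T).Nonempty := by
      rw [← Finset.card_pos]
      omega
    have hcard : (T \ S).card = (S \ T).card := by
      have h1 := Finset.card_sdiff_add_card_inter S T
      have h2 := Finset.card_sdiff_add_card_inter T S
      rw [Finset.inter_comm] at h2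
      omega
    obtain ⟨y, hy⟩ : (T \ S).Nonempty := by
      rw [← Finset.card_pos]
      omega
    rw [Finset.mem_sdiff] at hx hy
    have hyE : y ∉ S.erase x := fun h => hy.2 (Finset.mem_of_mem_erase h)
    have hSE : S.erase x ⊆ M := (Finset.erase_subset _ _).trans hS.1
    have h1 := h (S.erase x) x y hSE (hS.1 hx.1) (hT.1 hy.1) (Finset.notMem_erase _ _) hyE
    rw [Finset.insert_erase hx.1] at h1
    rw [h1]
    apply ih
    · refine ⟨Finset.insert_subset (hT.1 hy.1) hSE, ?_⟩
      rw [Finset.card_insert_of_notMem hyE, Finset.card_erase_add_one hx.1, hS.2]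
    · rw [Finset.insert_sdiff_of_mem _ hy.1, Finset.erase_sdiff_comm, Finset.card_erase_of_mem, hm]
      · rfl
      · exact Finset.mem_sdiff.2 hx

/-- A highest weight vector of weight `(1^j, 0^{n-2j}, (-1)^j)` in the span of the `p × p` minors
is a multiple of an explicit sum of minors. -/
theorem IsHighestWeightVector.exists_eq_sum_cut [CharZero K] {j p : ℕ} (h2j : 2 * j ≤ n)
    {f : CoordRing n K} (hf : IsHighestWeightVector (conjRep n K) (weight n j) f)
    (hmem : f ∈ minorSpan n K p) :
    (j ≤ p ∧ p + j ≤ n) ∧ ∃ c : K, c ≠ 0 ∧ ∀ ψ, evalAt ψ f =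
      c * ∑ S ∈ (middle n j).powersetCard (n - j - p), (cut j S ψ).det := by
  obtain ⟨hp, c, hc⟩ := exists_cut_decomposition h2j hf hmem
  refine ⟨hp, ?_⟩
  have hne : ((middle n j).powersetCard (n - j - p)).Nonempty := by
    by_contra h
    rw [Finset.not_nonempty_iff_eq_empty] at h
    exact hf.ne_zero (eq_zero_of_evalAt fun ψ => by rw [hc, h, Finset.sum_empty])
  obtain ⟨T, hT⟩ := hne
  have hconst : ∀ S ∈ (middle n j).powersetCard (n - j - p), c S = c T := by
    intro S hS
    rw [Finset.mem_powersetCard] at hS hT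
    -- The exchange hypothesis of `eq_of_exchange` concerns subsets of every size, so the
    -- coefficients are set to zero off the relevant size.
    let c' : Finset (Fin n) → K := fun S => if S.card = n - j - p then c S else 0
    have h1 := eq_of_exchange (middle n j) c' (by
      intro S x y hS hx hy hxS hyS
      simp only [c', Finset.card_insert_of_notMem hxS, Finset.card_insert_of_notMem hyS]
      split_ifs with hk
      · rcases lt_trichotomy x y with h | h | h
        · exact coeff_insert_eq hf.unipotent hc hS hk hx hy hxS hyS h
        · rw [h]
        · exact (coeff_insert_eq hf.unipotent hc hS hk hy hx hyS hxS h).symm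
      · rfl) (n - j - p) S T (Finset.mem_powersetCard.2 hS) (Finset.mem_powersetCard.2 hT)
    simpa [c', hS.2, hT.2] using h1
  have hc' : ∀ ψ, evalAt ψ f =
      c T * ∑ S ∈ (middle n j).powersetCard (n - j - p), (cut j S ψ).det := by
    intro ψ
    rw [hc, Finset.mul_sum]
    exact Finset.sum_congr rfl fun S hS => by rw [hconst S hS]
  refine ⟨c T, fun h => hf.ne_zero (eq_zero_of_evalAt fun ψ => ?_), hc'⟩
  rw [hc', h, zero_mul]

/-! ### The characteristic pencil with some rows replaced -/

/-- The matrix `t + ψ` over `K[t]`. -/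
def charPencil {ι : Type*} [DecidableEq ι] (ψ : Matrix ι ι K) : Matrix ι ι (Polynomial K) :=
  (Polynomial.X : Polynomial K) • (1 : Matrix ι ι (Polynomial K)) + ψ.map Polynomial.C

/-- The matrix `t + ψ` with the first `j` rows replaced by the last `j` unit vectors in reverse
order. -/
def pencil (j : ℕ) (ψ : Matrix (Fin n) (Fin n) K) : Matrix (Fin n) (Fin n) (Polynomial K) :=
  Matrix.of fun x => if (x : ℕ) < j then (1 : Matrix (Fin n) (Fin n) (Polynomial K)) (Fin.rev x)
    else charPencil ψ x

/-- Rows `s` and `Fin.rev s` are both the unit vector at `s`. -/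
theorem det_cut_eq_zero {j : ℕ} {S : Finset (Fin n)} {s : Fin n} (hs : s ∈ S)
    (hS : ∀ x ∈ S, ¬ (x : ℕ) < j) (hsj : n ≤ (s : ℕ) + j) (ψ : Matrix (Fin n) (Fin n) K) :
    (cut j S ψ).det = 0 := by
  have hlt : (Fin.rev s : ℕ) < j := by
    have := s.2
    rw [Fin.val_rev]
    omega
  have hr : Fin.rev s ∉ S := fun h => hS _ h hlt
  apply Matrix.det_zero_of_row_eq (i := s) (j := Fin.rev s)
  · intro h
    rw [← h] at hr
    exact hr hs
  · ext y
    simp only [cut, Matrix.of_apply, hs, hr, hlt, if_true, if_false, Matrix.one_apply, Fin.rev_rev]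

/-- The determinant is expanded multilinearly in the rows, each split into its `t`-part and its
constant part; `S` is the set of rows where the `t`-part is chosen. The first `j` rows have no
`t`-part, and by `det_cut_eq_zero` sets meeting the last `j` indices contribute nothing. -/
theorem coeff_det_pencil (j k : ℕ) (ψ : Matrix (Fin n) (Fin n) K) :
    (pencil j ψ).det.coeff k = ∑ S ∈ (middle n j).powersetCard k, (cut j S ψ).det := by
  classical
  let m : Fin n → Fin n → Polynomial K := fun x => if (x : ℕ) < j then 0 else
    (Polynomial.X : Polynomial K) • (1 : Matrix (Fin n) (Fin n) (Polynomial K)) x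
  let m' : Fin n → Fin n → Polynomial K := fun x y => Polynomial.C (cut j ∅ ψ x y)
  have hsplit : pencil j ψ = Matrix.of (m + m') := by
    ext x y : 1
    simp only [pencil, charPencil, m, m', cut, Matrix.of_apply, Pi.add_apply,
      Finset.notMem_empty, if_false]
    split_ifs with h
    · simp [Matrix.one_apply, apply_ite Polynomial.C]
    · simp
  have hterm : ∀ S : Finset (Fin n), Matrix.det (Matrix.of (S.piecewise m m')) =
      if ∀ x ∈ S, ¬ (x : ℕ) < j then
        Polynomial.X ^ S.card * Polynomial.C (cut j S ψ).det else 0 := by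
    intro S
    split_ifs with hS
    · have h1 : Matrix.of (S.piecewise m m') = Matrix.of fun x y =>
          (if x ∈ S then (Polynomial.X : Polynomial K) else 1) *
            ((cut j S ψ).map Polynomial.C) x y := by
        ext x y : 1
        by_cases hx : x ∈ S
        · simp [hx, m, cut, hS x hx, Matrix.one_apply, apply_ite Polynomial.C]
        · simp [hx, m', cut]
      rw [h1, Matrix.det_mul_column, Finset.prod_ite_mem, Finset.univ_inter, Finset.prod_const]
      congr 1
      exact (RingHom.map_det Polynomial.C _).symm
    · push Not at hS
      obtain ⟨x, hx, hxj⟩ := hS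
      apply Matrix.det_eq_zero_of_row_eq_zero x
      intro y
      simp [hx, m, hxj]
  have hdet : (pencil j ψ).det = ∑ S : Finset (Fin n), Matrix.det (Matrix.of (S.piecewise m m')) := by
    rw [hsplit]
    exact Matrix.detRowAlternating.map_add_univ m m'
  rw [hdet, Polynomial.finsetSum_coeff]
  simp only [hterm]
  rw [← Finset.sum_subset (Finset.subset_univ ((middle n j).powersetCard k))]
  · apply Finset.sum_congr rfl
    intro S hS
    rw [Finset.mem_powersetCard] at hS
    rw [if_pos, mul_comm, Polynomial.coeff_C_mul, Polynomial.coeff_X_pow, if_pos hS.2.symm, mul_one]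
    intro x hx h
    have := mem_middle.1 (hS.1 hx)
    omega
  · intro S _ hS
    split_ifs with h
    · rw [mul_comm, Polynomial.coeff_C_mul, Polynomial.coeff_X_pow]
      split_ifs with hk
      · have h1 : ¬ S ⊆ middle n j := fun h1 => hS (Finset.mem_powersetCard.2 ⟨h1, hk.symm⟩)
        obtain ⟨s, hs, hs'⟩ := Finset.not_subset.1 h1
        rw [mem_middle] at hs'
        have := h s hs
        rw [det_cut_eq_zero hs h (by omega), zero_mul]
      · rw [mul_zero]
    · exact Polynomial.coeff_zero k

/-! ### Divisibility of minors of the characteristic pencil -/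

/-- After a unimodular change of basis the columns of `t + ψ` are divisible by the powers
`t ^ e y`. -/
def ColumnsDivisible {ι : Type*} [DecidableEq ι] [Fintype ι] (ψ : Matrix ι ι K) (e : ι → ℕ) :
    Prop :=
  ∃ W W' : Matrix ι ι (Polynomial K), W * W' = 1 ∧
    ∀ x y, Polynomial.X ^ e y ∣ (charPencil ψ * W) x y

theorem ColumnsDivisible.conj {ψ : Matrix (Fin n) (Fin n) K} {e : Fin n → ℕ}
    (h : ColumnsDivisible ψ e) (g : GL (Fin n) K) :
    ColumnsDivisible ((↑g⁻¹ : Matrix (Fin n) (Fin n) K) * ψ * (↑g : Matrix (Fin n) (Fin n) K))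
      e := by
  obtain ⟨W, W', hW, hdiv⟩ := h
  have hg := g.mul_inv
  have hg' := g.inv_mul
  generalize (↑g : Matrix (Fin n) (Fin n) K) = a at hg hg' ⊢
  generalize (↑g⁻¹ : Matrix (Fin n) (Fin n) K) = b at hg hg' ⊢
  have hab : a.map Polynomial.C * b.map Polynomial.C = 1 := by
    rw [← Matrix.map_mul, hg]
    exact Matrix.map_one _ (map_zero _) (map_one _)
  have hba : b.map Polynomial.C * a.map Polynomial.C = 1 := by
    rw [← Matrix.map_mul, hg']
    exact Matrix.map_one _ (map_zero _) (map_one _)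
  refine ⟨b.map Polynomial.C * W, W' * a.map Polynomial.C, ?_, fun x y => ?_⟩
  · rw [Matrix.mul_assoc, ← Matrix.mul_assoc W, hW, Matrix.one_mul, hba]
  · have h1 : charPencil (b * ψ * a) * (b.map Polynomial.C * W) =
        b.map Polynomial.C * (charPencil ψ * W) := by
      have h2 : charPencil (b * ψ * a) * b.map Polynomial.C =
          b.map Polynomial.C * charPencil ψ := by
        rw [charPencil, charPencil, Matrix.add_mul, Matrix.mul_add, Matrix.map_mul, Matrix.map_mul,
          Matrix.mul_assoc _ (a.map _), hab, Matrix.mul_one, Matrix.smul_mul, Matrix.one_mul,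
          Matrix.mul_smul, Matrix.mul_one]
      rw [← Matrix.mul_assoc, h2, Matrix.mul_assoc]
    rw [h1, Matrix.mul_apply]
    exact Finset.dvd_sum fun z _ => Dvd.dvd.mul_left (hdiv z y) _

/-- Multiplication by the unimodular `W` changes the determinant by a unit. In each Leibniz term at
most `j` factors lie in replaced rows; the factors in the other columns `y` are divisible by `t ^ e
y`. -/
theorem ColumnsDivisible.pow_dvd_det_pencil {ψ : Matrix (Fin n) (Fin n) K} {e : Fin n → ℕ}
    (h : ColumnsDivisible ψ e) {j d : ℕ}
    (hd : ∀ T : Finset (Fin n), T.card ≤ j → d + ∑ y ∈ T, e y ≤ ∑ y, e y) :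
    Polynomial.X ^ d ∣ (pencil j ψ).det := by
  classical
  obtain ⟨W, W', hW, hdiv⟩ := h
  have hu : IsUnit W.det := by
    refine IsUnit.of_mul_eq_one W'.det ?_
    rw [← Matrix.det_mul, hW, Matrix.det_one]
  rw [← hu.dvd_mul_right, ← Matrix.det_mul, Matrix.det_apply]
  refine Finset.dvd_sum fun σ _ => ?_
  rw [Units.smul_def, zsmul_eq_mul]
  apply Dvd.dvd.mul_left
  set T : Finset (Fin n) := Finset.univ.filter fun y => (σ y : ℕ) < j with hT
  have hcard : T.card ≤ j := by
    rw [hT, ← Finset.card_map σ.toEmbedding]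
    refine (Finset.card_le_card (t := Finset.univ.filter fun y : Fin n => (y : ℕ) < j) ?_).trans ?_
    · intro y
      simp only [Finset.mem_map, Finset.mem_filter, Finset.mem_univ, true_and]
      rintro ⟨z, hz, rfl⟩
      exact hz
    · rw [Fin.card_filter_val_lt]
      exact min_le_right _ _
  have h1 : d ≤ ∑ y ∈ Finset.univ \ T, e y := by
    have h2 := Finset.sum_sdiff (f := e) (Finset.subset_univ T)
    have := hd T hcard
    omega
  rw [← Finset.prod_sdiff (Finset.subset_univ T)]
  apply Dvd.dvd.mul_right
  apply (pow_dvd_pow _ h1).trans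
  rw [← Finset.prod_pow_eq_pow_sum]
  apply Finset.prod_dvd_prod_of_dvd
  intro y hy
  have hy' : ¬ (σ y : ℕ) < j := by simpa [hT] using hy
  have h3 : (pencil j ψ * W) (σ y) y = (charPencil ψ * W) (σ y) y := by
    simp only [Matrix.mul_apply, pencil, Matrix.of_apply, hy', if_false]
  rw [h3]
  exact hdiv _ _

/-! ### Nilpotent matrices in Jordan form -/

section Jordan

variable {κ : Type*} (len : κ → ℕ)

/-- The indices of a basis adapted to Jordan blocks of sizes `len k`. -/
abbrev BlockIndex : Type _ := Σ k, Fin (len k)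

variable {len} in
theorem BlockIndex.ext_iff {a b : BlockIndex len} :
    a = b ↔ a.1 = b.1 ∧ (a.2 : ℕ) = b.2 := by
  constructor
  · rintro rfl
    exact ⟨rfl, rfl⟩
  · obtain ⟨k, x⟩ := a
    obtain ⟨l, y⟩ := b
    rintro ⟨h1, h2⟩
    obtain rfl : k = l := h1
    obtain rfl : x = y := Fin.ext h2
    rfl

/-- The nilpotent matrix with Jordan blocks of sizes `len k`. -/
def jordan [DecidableEq κ] (K : Type*) [Field K] : Matrix (BlockIndex len) (BlockIndex len) K :=
  Matrix.of fun a b => if a.1 = b.1 ∧ (b.2 : ℕ) = a.2 + 1 then 1 else 0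

/-- The exponents of the elementary divisors of `t + N`, for `N` nilpotent with Jordan blocks of
sizes `len k`. -/
def blockExponent (a : BlockIndex len) : ℕ := if (a.2 : ℕ) = 0 then len a.1 else 0

theorem sum_blockExponent [Fintype κ] : ∑ a, blockExponent len a = ∑ k, len k := by
  rw [Fintype.sum_sigma]
  refine Finset.sum_congr rfl fun k _ => ?_
  change ∑ x : Fin (len k), (if (x : ℕ) = 0 then len k else 0) = len k
  generalize len k = m
  rcases m with _ | m
  · rfl
  · rw [Finset.sum_eq_single 0]
    · simp
    · intro x _ hx
      have h : (x : ℕ) ≠ 0 := fun h => hx (Fin.ext h)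
      rw [if_neg h]
    · simp

variable [DecidableEq κ]

/-- The strictly lower triangular part of the change of basis diagonalizing `t + N`. -/
def lowerPart (K : Type*) [Field K] : Matrix (BlockIndex len) (BlockIndex len) (Polynomial K) :=
  Matrix.of fun a b => if a.1 = b.1 ∧ (b.2 : ℕ) = 0 ∧ (a.2 : ℕ) ≠ 0 then
    (-Polynomial.X) ^ (a.2 : ℕ) else 0

variable [Fintype κ]

theorem lowerPart_mul_self : lowerPart len K * lowerPart len K = 0 := by
  ext a b : 1
  rw [Matrix.mul_apply, Matrix.zero_apply]
  refine Finset.sum_eq_zero fun c _ => ?_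
  by_cases h : (c.2 : ℕ) = 0 <;> simp [lowerPart, h]

/-- The new first column of a block has entries `1, -t, (-t)^2, …`. Applying `t + N` telescopes to
zero except in the last row of the block, where `t (-t)^(len - 1)` remains. -/
theorem jordan_columnsDivisible : ColumnsDivisible (jordan len K) (blockExponent len) := by
  refine ⟨1 + lowerPart len K, 1 - lowerPart len K, ?_, fun a b => ?_⟩
  · rw [Matrix.add_mul, Matrix.mul_sub, Matrix.mul_sub, lowerPart_mul_self]
    simp
  · unfold blockExponent
    split_ifs with hb
    swap
    · simp
    have hcol : ∀ c : BlockIndex len, (1 + lowerPart len K) c b =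
        if c.1 = b.1 then (-Polynomial.X) ^ (c.2 : ℕ) else 0 := by
      intro c
      simp only [lowerPart, Matrix.add_apply, Matrix.one_apply, Matrix.of_apply,
        BlockIndex.ext_iff, hb]
      by_cases h1 : c.1 = b.1 <;> by_cases h2 : (c.2 : ℕ) = 0 <;> simp [h1, h2]
    have hmul : (charPencil (jordan len K) * (1 + lowerPart len K)) a b =
        Polynomial.X * (1 + lowerPart len K) a b +
          ∑ c, Polynomial.C (jordan len K a c) * (1 + lowerPart len K) c b := by
      rw [charPencil, Matrix.add_mul, Matrix.smul_mul, Matrix.one_mul, Matrix.add_apply,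
        Matrix.smul_apply, smul_eq_mul, Matrix.mul_apply]
      rfl
    rw [hmul]
    simp only [hcol]
    by_cases hab : a.1 = b.1
    · by_cases hlast : (a.2 : ℕ) + 1 < len a.1
      · rw [Finset.sum_eq_single (⟨a.1, ⟨a.2 + 1, hlast⟩⟩ : BlockIndex len)]
        · simp only [jordan, Matrix.of_apply, hab, and_self, if_true, Polynomial.C_1, pow_succ]
          ring_nf
          exact dvd_zero _
        · intro c _ hc
          have : ¬ (a.1 = c.1 ∧ (c.2 : ℕ) = a.2 + 1) := fun h =>
            hc (BlockIndex.ext_iff.2 ⟨h.1.symm, h.2⟩)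
          simp [jordan, this]
        · simp
      · rw [Finset.sum_eq_zero, if_pos hab, add_zero]
        · have h1 : len b.1 = a.2 + 1 := by
            have := a.2.2
            rw [← hab]
            omega
          rw [h1, pow_succ', neg_pow]
          exact mul_dvd_mul_left _ (Dvd.intro_left _ rfl)
        · intro c _
          have : ¬ (a.1 = c.1 ∧ (c.2 : ℕ) = a.2 + 1) := by
            rintro ⟨h1, h2⟩
            have h3 := c.2.2
            have h4 := congrArg len h1
            omega
          simp [jordan, this]
    · rw [Finset.sum_eq_zero, if_neg hab]
      · simp
      · intro c _
        by_cases h : a.1 = c.1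
        · have : ¬ c.1 = b.1 := fun h' => hab (h.trans h')
          simp [this]
        · simp [jordan, h]

theorem ColumnsDivisible.reindex {ι ι' : Type*} [DecidableEq ι] [Fintype ι] [DecidableEq ι']
    [Fintype ι'] {ψ : Matrix ι ι K} {e : ι → ℕ} (h : ColumnsDivisible ψ e) (E : ι ≃ ι') :
    ColumnsDivisible (ψ.submatrix E.symm E.symm) (e ∘ E.symm) := by
  obtain ⟨W, W', hW, hdiv⟩ := h
  refine ⟨W.submatrix E.symm E.symm, W'.submatrix E.symm E.symm, ?_, fun x y => ?_⟩
  · rw [Matrix.submatrix_mul_equiv, hW, Matrix.submatrix_one_equiv]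
  · have h1 : charPencil (ψ.submatrix E.symm E.symm) = (charPencil ψ).submatrix E.symm E.symm := by
      ext x y : 1
      simp [charPencil, Matrix.one_apply]
    rw [h1, Matrix.submatrix_mul_equiv]
    exact hdiv _ _

theorem val_finRotate {m : ℕ} (x : Fin m) :
    (finRotate m x : ℕ) = if (x : ℕ) + 1 = m then 0 else (x : ℕ) + 1 := by
  rcases m with _ | m
  · exact x.elim0
  · split_ifs with h
    · have : x = Fin.last m := Fin.ext (by simpa using h)
      rw [this, finRotate_last]
      rfl
    · rw [coe_finRotate_of_ne_last]
      intro hx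
      exact h (by simp [hx])

end Jordan

/-- The sizes of the Jordan blocks: `len k` for `k < i`, and then `d` times `1`. -/
def blockLen {i : ℕ} (len : Fin i → ℕ) (d : ℕ) : Fin i ⊕ Fin d → ℕ :=
  Sum.elim len fun _ => 1

/-! ### An ordering of the Jordan basis with a nonzero coefficient -/

variable {i d : ℕ} {len : Fin i → ℕ}

/-- The last vector of the `k`-th long block goes to position `k` and its first vector to `n - 1 -
k`. In `pencil i`, the row of the last vector is then replaced by the unit vector at the first one,
which closes the block into a cycle. These positions are distinct since `2 * i ≤ n` and long blocks
have size at least `2`. -/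
theorem exists_index_equiv (h2i : 2 * i ≤ n) (hlen : ∀ k, 2 ≤ len k)
    (hn : ∑ k, len k + d = n) :
    ∃ E : BlockIndex (blockLen len d) ≃ Fin n, ∀ (k : Fin i) (x : Fin (len k)),
      ((x : ℕ) = 0 → (E ⟨Sum.inl k, x⟩ : ℕ) + k + 1 = n) ∧
      ((x : ℕ) + 1 = len k → (E ⟨Sum.inl k, x⟩ : ℕ) = k) := by
  classical
  have hcard : Fintype.card (BlockIndex (blockLen len d)) = n := by
    rw [Fintype.card_sigma, Fintype.sum_sum_type]
    simp only [Fintype.card_fin]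
    simp [blockLen, hn]
  rcases Nat.eq_zero_or_pos n with h0 | hpos
  · refine ⟨Fintype.equivOfCardEq (hcard.trans (Fintype.card_fin n).symm), fun k => ?_⟩
    have := k.2
    omega
  -- Only the values on `s` below matter; the others are placeholders.
  let f : BlockIndex (blockLen len d) → Fin n := fun a =>
    Sum.elim (fun k : Fin i => if (a.2 : ℕ) = 0 then ⟨n - 1 - k, by omega⟩ else
      ⟨k, by have := k.2; omega⟩) (fun _ => ⟨0, hpos⟩) a.1
  let s : Finset (BlockIndex (blockLen len d)) := Finset.univ.filter fun a =>
    a.1.isLeft ∧ ((a.2 : ℕ) = 0 ∨ (a.2 : ℕ) + 1 = blockLen len d a.1)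
  have hf : Set.InjOn f s := by
    rintro ⟨k | k, x⟩ ha ⟨l | l, y⟩ hb hab
    · have ha' : (x : ℕ) = 0 ∨ (x : ℕ) + 1 = len k  :=
        (Finset.mem_filter.1 (Finset.mem_coe.1 ha)).2.2
      have hb' : (y : ℕ) = 0 ∨ (y : ℕ) + 1 = len l  :=
        (Finset.mem_filter.1 (Finset.mem_coe.1 hb)).2.2
      have hk := hlen k
      have hl := hlen l
      have hk2 := k.2
      have hl2 := l.2
      have hv := congrArg Fin.val hab
      simp only [f, Sum.elim_inl] at hv
      rw [BlockIndex.ext_iff]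
      have hkl : k = l := by
        apply Fin.ext
        split_ifs at hv <;> simp only at hv <;> omega
      subst hkl
      refine ⟨rfl, ?_⟩
      change (x : ℕ) = y
      split_ifs at hv <;> simp only at hv <;> omega
    · simp [s] at hb
    · simp [s] at ha
    · simp [s] at hb
  obtain ⟨g, hg⟩ := Finset.exists_equiv_extend_of_card_eq (hcard.trans (Finset.card_fin n).symm) (Finset.subset_univ _) hf
  refine ⟨g.trans (Equiv.subtypeUnivEquiv Finset.mem_univ), fun k x => ⟨fun hx => ?_, fun hx => ?_⟩⟩
  · have h1 := hg ⟨Sum.inl k, x⟩ (by simp [s, hx])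
    have hk := k.2
    change ((g ⟨Sum.inl k, x⟩ : Fin n) : ℕ) + k + 1 = n
    rw [h1]
    simp only [f, Sum.elim_inl, if_pos hx]
    omega
  · have h1 := hg ⟨Sum.inl k, x⟩ (Finset.mem_filter.2 ⟨Finset.mem_univ _, rfl, Or.inr hx⟩)
    have hk := hlen k
    have hx' : (x : ℕ) ≠ 0 := by omega
    change ((g ⟨Sum.inl k, x⟩ : Fin n) : ℕ) = k
    rw [h1]
    simp only [f, Sum.elim_inl, if_neg hx']

/-- Each block of size `1` contributes a row with the single entry `t`. After `t ^ d` is factored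
out, the remaining matrix `G` at `t = 0` is the permutation matrix rotating each block cyclically,
so its determinant is a sign. -/
theorem coeff_det_pencil_jordan_ne_zero (hlen : ∀ k, 2 ≤ len k)
    (E : BlockIndex (blockLen len d) ≃ Fin n)
    (hE : ∀ (k : Fin i) (x : Fin (len k)),
      ((x : ℕ) = 0 → (E ⟨Sum.inl k, x⟩ : ℕ) + k + 1 = n) ∧
      ((x : ℕ) + 1 = len k → (E ⟨Sum.inl k, x⟩ : ℕ) = k)) :
    (pencil i ((jordan (blockLen len d) K).submatrix E.symm E.symm)).det.coeff d ≠ 0 := by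
  classical
  set P := pencil i ((jordan (blockLen len d) K).submatrix E.symm E.symm) with hP
  have hPE : ∀ a b, P (E a) (E b) = if (E a : ℕ) < i then
      (if Fin.rev (E a) = E b then 1 else 0) else
      (if a = b then Polynomial.X else 0) + Polynomial.C (jordan (blockLen len d) K a b) := by
    intro a b
    simp only [hP, pencil, charPencil, Matrix.of_apply]
    split_ifs <;> simp_all [Matrix.one_apply]
  have hlt : ∀ a, (E a : ℕ) < i → ∃ k : Fin i, a.1 = Sum.inl k ∧
      (a.2 : ℕ) + 1 = blockLen len d a.1 ∧ (E a : ℕ) = k := by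
    intro a ha
    have h2 := hlen ⟨E a, ha⟩
    have h1 := (hE ⟨E a, ha⟩ ⟨len ⟨E a, ha⟩ - 1, by omega⟩).2 (by simp only; omega)
    have h3 : a = ⟨Sum.inl ⟨E a, ha⟩, ⟨len ⟨E a, ha⟩ - 1, by simp only [blockLen, Sum.elim_inl]; omega⟩⟩ := by
      apply E.injective
      apply Fin.ext
      exact h1.symm
    refine ⟨⟨E a, ha⟩, (BlockIndex.ext_iff.1 h3).1, ?_, rfl⟩
    have h4 := (BlockIndex.ext_iff.1 h3).2
    have h5 := congrArg (blockLen len d) (BlockIndex.ext_iff.1 h3).1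
    simp only [blockLen, Sum.elim_inl] at h4 h5 ⊢
    omega
  let v : BlockIndex (blockLen len d) → Polynomial K := fun a =>
    Sum.elim (fun _ => 1) (fun _ => Polynomial.X) a.1
  let G : Matrix (BlockIndex (blockLen len d)) (BlockIndex (blockLen len d)) (Polynomial K) :=
    Matrix.of fun a b => Sum.elim (fun _ => P (E a) (E b)) (fun _ => if a = b then 1 else 0) a.1
  have hfac : P.submatrix E E = Matrix.of fun a b => v a * G a b := by
    ext a b : 1
    obtain ⟨k | k, x⟩ := a
    · simp [v, G]
    · have h1 : ¬ (E ⟨Sum.inr k, x⟩ : ℕ) < i := fun h => by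
        obtain ⟨l, hl, _⟩ := hlt _ h
        simp at hl
      have h2 : jordan (blockLen len d) K ⟨Sum.inr k, x⟩ b = 0 := by
        simp only [jordan, Matrix.of_apply]
        rw [if_neg]
        rintro ⟨h3, h4⟩
        have h5 := b.2.2
        have h6 := congrArg (blockLen len d) h3
        simp only [blockLen, Sum.elim_inr] at h5 h6 h4
        omega
      simp [hPE, h1, h2, v, G]
  have hv : ∏ a, v a = Polynomial.X ^ d := by
    rw [Fintype.prod_sigma, Fintype.prod_sum_type]
    simp only [v, Sum.elim_inl, Sum.elim_inr, Finset.prod_const, Finset.card_univ,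
      Fintype.card_fin]
    simp [blockLen]
  have hG : G.map (Polynomial.eval 0) = (1 : Matrix _ _ K).submatrix
      (Equiv.sigmaCongrRight fun k => finRotate (blockLen len d k)) id := by
    ext a b : 1
    have hrot : (Equiv.sigmaCongrRight fun k => finRotate (blockLen len d k)) a = b ↔
        a.1 = b.1 ∧ (b.2 : ℕ) = if (a.2 : ℕ) + 1 = blockLen len d a.1 then (0 : ℕ) else (a.2 : ℕ) + 1 := by
      rw [BlockIndex.ext_iff, ← val_finRotate]
      exact and_congr Iff.rfl eq_comm
    rw [Matrix.submatrix_apply, Matrix.one_apply, id, Matrix.map_apply]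
    simp only [hrot]
    obtain ⟨k | k, x⟩ := a
    · simp only [G, Matrix.of_apply, Sum.elim_inl, hPE]
      by_cases hx : (x : ℕ) + 1 = blockLen len d (Sum.inl k)
      · have h1 := (hE k x).2 hx
        have hk := k.2
        have hk2 := hlen k
        rw [if_pos (by omega)]
        have h3 : Fin.rev (E ⟨Sum.inl k, x⟩) = E b ↔ Sum.inl k = b.1 ∧ (b.2 : ℕ) = 0 := by
          have hpos : 0 < blockLen len d (Sum.inl k) := by omega
          have h4 : (E ⟨Sum.inl k, ⟨0, hpos⟩⟩ : ℕ) + k + 1 = n := (hE k ⟨0, hpos⟩).1 rfl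
          have h5 : Fin.rev (E ⟨Sum.inl k, x⟩) = E ⟨Sum.inl k, ⟨0, hpos⟩⟩ := by
            apply Fin.ext
            rw [Fin.val_rev, h1]
            omega
          rw [h5, E.injective.eq_iff, BlockIndex.ext_iff]
          exact and_congr Iff.rfl eq_comm
        simp only [h3, hx, if_true]
        split_ifs <;> simp
      · have h1 : ¬ (E ⟨Sum.inl k, x⟩ : ℕ) < i := fun h => by
          obtain ⟨l, hl, hl', _⟩ := hlt _ h
          exact hx hl'
        simp only [h1, hx, if_false, jordan, Matrix.of_apply]
        split_ifs <;> simp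
    · have hx : (x : ℕ) = 0 := by
        have := x.2
        simp only [blockLen, Sum.elim_inr] at this
        omega
      simp only [G, Matrix.of_apply, Sum.elim_inr, BlockIndex.ext_iff, hx]
      simp only [blockLen, Sum.elim_inr, zero_add, if_true, eq_comm (a := (0 : ℕ))]
      split_ifs <;> simp
  rw [← Matrix.det_submatrix_equiv_self E, hfac, Matrix.det_mul_column, hv,
    Polynomial.coeff_X_pow_mul', if_pos le_rfl, Nat.sub_self, Polynomial.coeff_zero_eq_eval_zero]
  have h1 : Polynomial.eval 0 G.det = (G.map (Polynomial.eval 0)).det :=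
    RingHom.map_det (Polynomial.evalRingHom 0) G
  rw [h1, hG, Matrix.det_permute, Matrix.det_one, mul_one]
  rcases Int.units_eq_one_or (Equiv.Perm.sign
    (Equiv.sigmaCongrRight fun k => finRotate (blockLen len d k))) with h | h <;> simp [h]

/-! ### Vanishing of the spaces of equations -/

theorem IsHighestWeightVector.exists_eq_coeff [CharZero K] {j p : ℕ} (h2j : 2 * j ≤ n)
    {f : CoordRing n K} (hf : IsHighestWeightVector (conjRep n K) (weight n j) f)
    (hmem : f ∈ minorSpan n K p) :
    (j ≤ p ∧ p + j ≤ n) ∧ ∃ c : K, c ≠ 0 ∧ ∀ ψ, evalAt ψ f =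
      c * (pencil j ψ).det.coeff (n - j - p) := by
  simp only [coeff_det_pencil]
  exact hf.exists_eq_sum_cut h2j hmem

/-- The vectors whose translates all vanish at a given matrix. -/
def vanishingSubrep (σ : Subrepresentation (conjRep n K)) (φ : Matrix (Fin n) (Fin n) K) :
    Subrepresentation σ.toRepresentation where
  toSubmodule :=
    { carrier := {x | ∀ g, evalAt φ (conjRep n K g x) = 0}
      add_mem' := fun {x y} hx hy g => by
        have h1 := hx g
        have h2 := hy g
        rw [Submodule.coe_add, map_add, map_add, h1, h2, add_zero]
      zero_mem' := fun g => by simp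
      smul_mem' := fun c x hx g => by
        have h1 := hx g
        rw [Submodule.coe_smul, map_smul, map_smul, h1, smul_zero] }
  apply_mem_toSubmodule g x hx h := by
    have h1 := hx (h * g)
    rw [map_mul] at h1
    exact h1

/-- In an irreducible summand, `vanishingSubrep` contains the highest weight vector, because the
divisibility holds for every conjugate of `φ`. Being nonzero it is the whole summand. -/
theorem evalAt_eq_zero_of_mem_U [CharZero K] {j p : ℕ} {φ : Matrix (Fin n) (Fin n) K}
    {e : Fin n → ℕ} (hφ : ColumnsDivisible φ e)
    (he : ∀ T : Finset (Fin n), T.card ≤ j → n - j - p + 1 + ∑ y ∈ T, e y ≤ ∑ y, e y)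
    {f : CoordRing n K} (hf : f ∈ U n K j p) : evalAt φ f = 0 := by
  have hle : U n K j p ≤ LinearMap.ker (evalAt φ).toLinearMap := by
    refine iSup₂_le fun σ hσ => ?_
    obtain ⟨h2j, hσp, hirr, v, hv, hw⟩ := hσ
    obtain ⟨-, c, -, hc⟩ := hw.exists_eq_coeff h2j (hσp hv)
    have hvan : (⟨v, hv⟩ : σ.toSubmodule) ∈ (vanishingSubrep σ φ).toSubmodule := by
      intro g
      rw [evalAt_conjRep, hc]
      have h1 := Polynomial.X_pow_dvd_iff.1 ((hφ.conj g).pow_dvd_det_pencil he)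
        (n - j - p) (Nat.lt_succ_self _)
      rw [h1, mul_zero]
    have htop : vanishingSubrep σ φ = ⊤ := by
      refine (hirr.eq_bot_or_eq_top _).resolve_left fun hbot => ?_
      rw [hbot] at hvan
      have h1 : (⟨v, hv⟩ : σ.toSubmodule) = 0 := (Submodule.mem_bot K).1 hvan
      exact hw.ne_zero (congrArg Subtype.val h1)
    intro x hx
    have h1 : (⟨x, hx⟩ : σ.toSubmodule) ∈ (vanishingSubrep σ φ).toSubmodule := by
      rw [htop]
      exact Submodule.mem_top
    have h2 := h1 1
    rw [map_one] at h2
    exact h2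
  exact hle hf

theorem exists_highestWeightVector_of_U_ne_bot {j p : ℕ} (hU : U n K j p ≠ ⊥) :
    2 * j ≤ n ∧ ∃ v ∈ U n K j p, v ∈ minorSpan n K p ∧
      IsHighestWeightVector (conjRep n K) (weight n j) v := by
  by_contra hcon
  apply hU
  rw [eq_bot_iff]
  refine iSup₂_le fun σ hσ => ?_
  exfalso
  apply hcon
  obtain ⟨h2j, hσp, hirr, v, hv, hw⟩ := hσ
  exact ⟨h2j, v, le_iSup₂ (f := fun (σ : Subrepresentation (conjRep n K))
    (_ : 2 * j ≤ n ∧ σ.toSubmodule ≤ minorSpan n K p ∧ σ.toRepresentation.IsIrreducible ∧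
      ∃ v ∈ σ.toSubmodule, IsHighestWeightVector (conjRep n K) (weight n j) v) => σ.toSubmodule)
    σ ⟨h2j, hσp, hirr, v, hv, hw⟩ hv, hσp hv, hw⟩

/-! ### Partial sums of partitions -/

/-- The partial sum `μ_1 + ⋯ + μ_j`. -/
def partialSum (μ : n.Partition) (j : ℕ) : ℕ := ∑ x ∈ Finset.Icc 1 j, part μ x

theorem partialSum_succ (μ : n.Partition) (j : ℕ) :
    partialSum μ (j + 1) = partialSum μ j + part μ (j + 1) :=
  Finset.sum_Icc_succ_top (by omega) _

theorem part_antitone (μ : n.Partition) {a b : ℕ} (hab : a ≤ b) : part μ b ≤ part μ a := by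
  unfold part
  have hs : (μ.parts.sort (· ≥ ·)).Pairwise (· ≥ ·) := Multiset.pairwise_sort _ _
  generalize μ.parts.sort (· ≥ ·) = l at hs
  rcases lt_or_ge (b - 1) l.length with hb | hb
  · have ha : a - 1 < l.length := by omega
    rw [List.getD_eq_getElem _ _ hb, List.getD_eq_getElem _ _ ha]
    rcases (show a - 1 ≤ b - 1 by omega).eq_or_lt with h | h
    · simp [h]
    · exact List.pairwise_iff_getElem.1 hs _ _ ha hb h
  · rw [List.getD_eq_default _ _ hb]
    exact Nat.zero_le _

theorem partialSum_eq_sum_take (μ : n.Partition) (j : ℕ) :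
    partialSum μ j = ((μ.parts.sort (· ≥ ·)).take j).sum := by
  induction j with
  | zero => simp [partialSum]
  | succ j ih =>
    rw [partialSum_succ, ih, part, Nat.add_sub_cancel]
    rcases lt_or_ge j (μ.parts.sort (· ≥ ·)).length with h | h
    · rw [List.getD_eq_getElem _ _ h, List.sum_take_succ _ _ h]
    · rw [List.getD_eq_default _ _ h, List.take_of_length_le h, List.take_of_length_le (by omega),
        add_zero]

theorem sum_sort_parts (μ : n.Partition) : (μ.parts.sort (· ≥ ·)).sum = n := by
  rw [← Multiset.sum_coe, Multiset.sort_eq, μ.parts_sum]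

theorem partialSum_eq_of_part_eq_zero (μ : n.Partition) {j : ℕ} (hj : 1 ≤ j)
    (h : part μ j = 0) : partialSum μ j = n := by
  have hlen : (μ.parts.sort (· ≥ ·)).length ≤ j - 1 := by
    by_contra! hlt
    rw [part, List.getD_eq_getElem _ _ hlt] at h
    have h1 := List.getElem_mem hlt
    rw [Multiset.mem_sort] at h1
    have := μ.parts_pos h1
    omega
  rw [partialSum_eq_sum_take, List.take_of_length_le (by omega), sum_sort_parts]

theorem partialSum_mono (μ : n.Partition) {a b : ℕ} (hab : a ≤ b) :
    partialSum μ a ≤ partialSum μ b :=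
  Finset.sum_le_sum_of_subset (Finset.Icc_subset_Icc_right hab)

theorem mul_part_le_partialSum (μ : n.Partition) (j : ℕ) : j * part μ j ≤ partialSum μ j := by
  have h := Finset.card_nsmul_le_sum (Finset.Icc 1 j) (part μ) (part μ j) fun x hx =>
    part_antitone μ (Finset.mem_Icc.1 hx).2
  simpa [partialSum] using h

theorem partialSum_add_le (μ : n.Partition) (j l : ℕ) :
    partialSum μ (j + l) ≤ partialSum μ j + l * part μ j := by
  induction l with
  | zero => simp
  | succ l ih =>
    rw [← add_assoc, partialSum_succ, Nat.succ_mul]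
    have := part_antitone μ (show j ≤ j + l + 1 by omega)
    omega

/-! ### Almost equal Jordan blocks -/

/-- Block sizes: `m` almost equal ones with sum `s`, followed by `l`. -/
def balancedLen (m s l : ℕ) (k : Fin (m + 1)) : ℕ :=
  if (k : ℕ) = m then l else s / m + if (k : ℕ) < s % m then 1 else 0

theorem sum_fin_lt (m r : ℕ) (h : r ≤ m) : ∑ k : Fin m, (if (k : ℕ) < r then 1 else 0) = r := by
  rw [Finset.sum_boole, Fin.card_filter_val_lt, min_eq_right h, Nat.cast_id]

theorem sum_balancedLen {m s l : ℕ} (h : m = 0 → s = 0) :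
    ∑ k, balancedLen m s l k = s + l := by
  have hmod : s % m ≤ m := by
    rcases Nat.eq_zero_or_pos m with h0 | h0
    · simp [h0, h h0]
    · exact (Nat.mod_lt _ h0).le
  rw [Fin.sum_univ_castSucc]
  have h1 : ∀ k : Fin m, balancedLen m s l k.castSucc =
      s / m + if (k : ℕ) < s % m then 1 else 0 := by
    intro k
    have := k.2.ne
    simp [balancedLen, this]
  simp only [h1, Finset.sum_add_distrib, sum_fin_lt _ _ hmod]
  simp [balancedLen, Nat.div_add_mod]

/-- Each exponent is at most `s / m` plus an excess; every excess is at most `1`, and the excesses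
total at most `s % m`. The two bounds use these two facts. -/
theorem sum_blockExponent_le {m s l d : ℕ} (hm : 0 < m) (hl : l ≤ s / m) (h1 : 1 ≤ s / m)
    (T : Finset (BlockIndex (blockLen (balancedLen m s l) d))) :
    ∑ a ∈ T, blockExponent (blockLen (balancedLen m s l) d) a ≤ T.card * (s / m + 1) ∧
    ∑ a ∈ T, blockExponent (blockLen (balancedLen m s l) d) a ≤ T.card * (s / m) + s % m := by
  let ε : Fin (m + 1) ⊕ Fin d → ℕ :=
    Sum.elim (fun k => if (k : ℕ) < s % m then 1 else 0) fun _ => 0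
  have hε1 : ∀ k, ε k ≤ 1 := by
    rintro (k | k)
    · simp only [ε, Sum.elim_inl]
      split_ifs <;> omega
    · simp [ε]
  have hlen : ∀ k, blockLen (balancedLen m s l) d k ≤ s / m + ε k := by
    rintro (k | k)
    · simp only [blockLen, balancedLen, ε, Sum.elim_inl]
      split_ifs <;> omega
    · simpa [blockLen, ε] using h1
  have hle : ∀ a, blockExponent (blockLen (balancedLen m s l) d) a ≤
      s / m + if (a.2 : ℕ) = 0 then ε a.1 else 0 := by
    intro a
    unfold blockExponent
    split_ifs
    · exact hlen _
    · exact Nat.zero_le _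
  have hsum : ∑ a : BlockIndex (blockLen (balancedLen m s l) d),
      (if (a.2 : ℕ) = 0 then ε a.1 else 0) ≤ s % m := by
    have h2 : ∑ k, ε k = s % m := by
      rw [Fintype.sum_sum_type]
      simp only [ε, Sum.elim_inl, Sum.elim_inr, Finset.sum_const_zero, add_zero]
      exact sum_fin_lt _ _ ((Nat.mod_lt _ hm).le.trans (Nat.le_succ m))
    rw [Fintype.sum_sigma, ← h2]
    refine Finset.sum_le_sum fun k _ => ?_
    change ∑ x : Fin (blockLen (balancedLen m s l) d k), (if (x : ℕ) = 0 then ε k else 0) ≤ ε k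
    generalize blockLen (balancedLen m s l) d k = N
    rcases N with _ | N
    · simp
    · rw [Fin.sum_univ_succ]
      simp
  constructor
  · rw [← smul_eq_mul]
    refine Finset.sum_le_card_nsmul _ _ _ fun a _ => (hle a).trans ?_
    have := hε1 a.1
    split_ifs <;> omega
  · refine (Finset.sum_le_sum fun a _ => hle a).trans ?_
    rw [Finset.sum_add_distrib, Finset.sum_const, smul_eq_mul]
    exact Nat.add_le_add_left ((Finset.sum_le_sum_of_subset (Finset.subset_univ T)).trans hsum) _

/-- Any `j` elementary divisor exponents of the balanced Jordan matrix have sum at most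
`μ_1 + ⋯ + μ_j`. -/
theorem sum_blockExponent_le_partialSum (μ : n.Partition) {m l d j : ℕ} (hjm : j ≤ m)
    (hl : 0 < m → l ≤ partialSum μ m / m) (h1 : 0 < l)
    (T : Finset (BlockIndex (blockLen (balancedLen m (partialSum μ m) l) d))) (hT : T.card ≤ j) :
    ∑ a ∈ T, blockExponent (blockLen (balancedLen m (partialSum μ m) l) d) a ≤
      partialSum μ j := by
  rcases Nat.eq_zero_or_pos j with rfl | hj
  · rw [Nat.le_zero, Finset.card_eq_zero] at hT
    simp [hT]
  have hm : 0 < m := by omega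
  have hlm := hl hm
  obtain ⟨hA, hB⟩ := sum_blockExponent_le (d := d) hm hlm (by omega) T
  set q := partialSum μ m / m with hq
  -- If `μ_j > q`, then `j (q + 1) ≤ j μ_j` suffices. Otherwise `μ_{j+1}, …, μ_m` are at most `q`,
  -- and removing them from `μ_1 + ⋯ + μ_m = m q + r`, with `r` the remainder, leaves `μ_1 + ⋯ + μ_j
  -- ≥ j q + r`.
  by_cases hpq : q + 1 ≤ part μ j
  · calc _ ≤ T.card * (q + 1) := hA
      _ ≤ j * part μ j := Nat.mul_le_mul hT hpq
      _ ≤ _ := mul_part_le_partialSum μ j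
  · refine hB.trans ?_
    obtain ⟨c, rfl⟩ := Nat.exists_eq_add_of_le hjm
    have h2 := partialSum_add_le μ j c
    have h3 := Nat.div_add_mod (partialSum μ (j + c)) (j + c)
    rw [← hq] at h3
    have h4 : c * part μ j ≤ c * q := Nat.mul_le_mul_left _ (by omega)
    have h5 : T.card * q ≤ j * q := Nat.mul_le_mul_right _ hT
    have h6 : (j + c) * q = j * q + c * q := Nat.add_mul _ _ _
    omega

/-- With `i = m + 1`, one has `μ(i) - μ(m) = μ_i - 1` and `(μ(m) - 1) / m = (μ_1 + ⋯ + μ_m) / m -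
1`, so the floor condition becomes the stated bound. -/
theorem succ_part_le_div {m : ℕ} (μ : n.Partition) (hm : 0 < m)
    (hi : m + 1 ≤ partialSum μ (m + 1)) (hm' : m ≤ partialSum μ m)
    (hlt : (level μ (m + 1) : ℤ) < (level μ m : ℤ) +
      ⌊((level μ m : ℚ) - 1) / (((m + 1 : ℕ) : ℚ) - 1)⌋) :
    part μ (m + 1) + 1 ≤ partialSum μ m / m := by
  have h1 : level μ (m + 1) + (m + 1) = partialSum μ (m + 1) + 1 := by
    change partialSum μ (m + 1) + 1 - (m + 1) + (m + 1) = _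
    omega
  have h2 : level μ m + m = partialSum μ m + 1 := by
    change partialSum μ m + 1 - m + m = _
    omega
  rw [partialSum_succ] at h1
  have h3 : ((part μ (m + 1) : ℕ) : ℤ) ≤
      ⌊((level μ m : ℚ) - 1) / (((m + 1 : ℕ) : ℚ) - 1)⌋ := by
    omega
  rw [Int.le_floor] at h3
  have hmq : (0 : ℚ) < ((m + 1 : ℕ) : ℚ) - 1 := by
    push_cast
    have : (0 : ℚ) < m := by exact_mod_cast hm
    linarith
  rw [le_div_iff₀ hmq] at h3
  have h4 : (level μ m : ℚ) + m = partialSum μ m + 1 := by exact_mod_cast h2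
  rw [Nat.le_div_iff_mul_le hm]
  have h5 : ((part μ (m + 1) + 1 : ℕ) : ℚ) * m ≤ partialSum μ m := by
    push_cast at h3 ⊢
    linarith
  exact_mod_cast h5

end NilpotentOrbit

end

/-! ### The separating nilpotent matrix -/

theorem proposition3p6 (K : Type*) [Field K] [CharZero K] (n : ℕ) (μ : n.Partition)
    (i : ℕ) (hi1 : 1 ≤ i) (hin : i ≤ n)
    -- for `i = 1` the quotient by `i - 1` is read as infinite: there is no condition
    (hlt : 2 ≤ i → (NilpotentOrbit.level μ i : ℤ) < (NilpotentOrbit.level μ (i - 1) : ℤ) +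
      ⌊((NilpotentOrbit.level μ (i - 1) : ℚ) - 1) / ((i : ℚ) - 1)⌋)
    (hU : NilpotentOrbit.U n K i (NilpotentOrbit.level μ i) ≠ ⊥) :
    ¬ (NilpotentOrbit.U n K i (NilpotentOrbit.level μ i) : Set (NilpotentOrbit.CoordRing n K)) ⊆
      (NilpotentOrbit.previousIdeal K μ i : Set (NilpotentOrbit.CoordRing n K)) := by
  classical
  open NilpotentOrbit in
  obtain ⟨h2i, v, hvU, hvp, hv⟩ := exists_highestWeightVector_of_U_ne_bot hU
  obtain ⟨⟨-, hpn⟩, c, hc0, hc⟩ := hv.exists_eq_coeff h2i hvp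
  obtain ⟨m, rfl⟩ : ∃ m, i = m + 1 := ⟨i - 1, by omega⟩
  have hlev : ∀ j, level μ j = partialSum μ j + 1 - j := fun j => rfl
  -- The nonvanishing of `U_{i,μ(i)}` leaves room for one extra box in the first `i` blocks; it also
  -- forces `μ_i ≥ 1`, since otherwise the partial sum would be `n`.
  have hsn : partialSum μ (m + 1) + 1 ≤ n := by
    rw [hlev] at hpn
    omega
  have hpart : 1 ≤ part μ (m + 1) := by
    by_contra h
    have := partialSum_eq_of_part_eq_zero μ (j := m + 1) (by omega) (by omega)
    omega
  -- This makes the truncated subtraction in `level μ j` exact for `j ≤ i`.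
  have hge : ∀ j ≤ m + 1, j ≤ partialSum μ j := fun j hj =>
    (Nat.le_mul_of_pos_right j (hpart.trans (part_antitone μ hj))).trans
      (mul_part_le_partialSum μ j)
  have hdiv : 0 < m → part μ (m + 1) + 1 ≤ partialSum μ m / m := fun hm =>
    succ_part_le_div μ hm (hge _ le_rfl) (hge _ (Nat.le_succ m)) (hlt (by omega))
  set len := balancedLen m (partialSum μ m) (part μ (m + 1) + 1) with hlen
  have hlen2 : ∀ k, 2 ≤ len k := by
    intro k
    simp only [hlen, balancedLen]
    split_ifs with h1
    · omega
    all_goals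
      have := hdiv (by have := k.2; omega)
      omega
  have hsum : ∑ k, len k = partialSum μ (m + 1) + 1 := by
    rw [hlen, sum_balancedLen, partialSum_succ, add_assoc]
    -- For `m = 0` there are no balanced blocks, and the empty partial sum is indeed `0`.
    rintro rfl
    simp [partialSum]
  obtain ⟨d, hd⟩ := Nat.exists_eq_add_of_le hsn
  obtain ⟨E, hE⟩ := exists_index_equiv (d := d) h2i hlen2 (by omega)
  set φ := (jordan (blockLen len d) K).submatrix E.symm E.symm with hφ
  have hcol : ColumnsDivisible φ (blockExponent (blockLen len d) ∘ E.symm) :=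
    (jordan_columnsDivisible _).reindex E
  have htotal : ∑ y, (blockExponent (blockLen len d) ∘ E.symm) y = n := by
    refine (Equiv.sum_comp E.symm (blockExponent (blockLen len d))).trans ?_
    rw [sum_blockExponent, Fintype.sum_sum_type]
    simp only [blockLen, Sum.elim_inl, Sum.elim_inr, hsum, Finset.sum_const, Finset.card_univ,
      Fintype.card_fin, smul_eq_mul, mul_one]
    exact hd.symm
  have hbound : ∀ j ≤ m, ∀ T : Finset (Fin n), T.card ≤ j →
      ∑ y ∈ T, (blockExponent (blockLen len d) ∘ E.symm) y ≤ partialSum μ j := by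
    intro j hj T hT
    have h1 := sum_blockExponent_le_partialSum μ hj hdiv (Nat.succ_pos _)
      (T.map E.symm.toEmbedding) (by rwa [Finset.card_map])
    rw [Finset.sum_map] at h1
    exact h1
  have hne : evalAt φ v ≠ 0 := by
    have h1 : n - (m + 1) - level μ (m + 1) = d := by
      have := hge _ (le_refl (m + 1))
      rw [hlev]
      omega
    rw [hc, h1]
    exact mul_ne_zero hc0 (coeff_det_pencil_jordan_ne_zero hlen2 E hE)
  intro hsub
  apply hne
  have hker : previousIdeal K μ (m + 1) ≤ RingHom.ker (evalAt φ) := by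
    refine Ideal.span_le.2 (Set.union_subset ?_ ?_)
    -- For `j = 0` the determinant is divisible by `t ^ n`, and `p ≥ 1` gives a coefficient of lower
    -- degree.
    · refine Set.iUnion₂_subset fun p hp f hf => ?_
      refine evalAt_eq_zero_of_mem_U hcol (fun T hT => ?_) hf
      have h1 := hp.1
      have h2 := hbound 0 (Nat.zero_le _) T hT
      have h3 : partialSum μ 0 = 0 := by simp [partialSum]
      rw [htotal]
      omega
    -- The required exponent `n - j - μ(j) + 1` equals `n - (μ_1 + ⋯ + μ_j)`, exactly what `hbound`
    -- provides.
    · refine Set.iUnion₂_subset fun j hj f hf => ?_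
      refine evalAt_eq_zero_of_mem_U hcol (fun T hT => ?_) hf
      have hjm : j ≤ m := Nat.lt_succ_iff.1 hj.2
      have h2 := hbound j hjm T hT
      have h3 := hge j (by omega)
      have h4 := partialSum_mono μ (show j ≤ m + 1 by omega)
      rw [htotal, hlev]
      omega
  exact hker (hsub hvU)
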